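/- Let $d\ge 1$ and let $[n]$ be a ground set whose elements carry vectors $v_1,\dots,v_n\in\mathbb R^d$. Let $\mathcal M$ be a matroid on $[n]$ of rank $k$. For a basis $S$ of $\mathcal M$ put $\mu(S)=\det\big(\sum_{i\in S}v_iv_i^{\top}\big)$ if $k\ge d$, and let $\mu(S)=\det\big(\langle v_i,v_j\rangle\big)_{i,j\in S}$ be the squared volume of the parallelepiped spanned by $(v_i)_{i\in S}$ if $k\le d$ (the two agree for $k=d$). An $\alpha$-composable coreset of size at most $b$ is a map $c$ assigning to every $V\subseteq[n]$ a subset $c(V)\subseteq V$ with $|c(V)|\le b$, computed from the matroid and the vectors $(v_i)_{i\in V}$ only, such that for every finite collection $V_1,\dots,V_m\subseteq[n]$ $$\alpha\cdot\max\Big\{\mu(T): T\text{ a basis of }\mathcal M,\ T\subseteq\bigcup_{j}c(V_j)\Big\}\ \ge\ \max\Big\{\mu(S): S\text{ a basis of }\mathcal M,\ S\subseteq\bigcup_{j}V_j\Big\},$$ where, whenever $\bigcup_j V_j$ contains a basis, so does $\bigcup_j c(V_j)$. **Theorem.** There is an absolute constant $C$ (so that the $O(\cdot)$ bounds below hold with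 constant $C$) such that the following holds for determinant maximization over the bases of $\mathcal M$ with the convention $0^0=1$. 1. Let $\mathcal M$ be the partition matroid given by a partition $P_1,\dots,P_s$ of $[n]$ and integers $k_1,\dots,k_s\ge 0$ (a set $I$ is independent iff $|I\cap P_i|\le k_i$ for all $i$), and let $k$ be its rank. - If $k\le d$, there is a $k^{2k}$-composable coreset of size at most $C\,sk$. - If $k\ge d$, there is a $d^{2d}$-composable coreset of size at most $C\,kd$. 2. Let $\mathcal M$ be the laminar matroid given by a laminar family $\mathcal F$ of subsets of $[n]$ (any two members are disjoint or nested) and integers $k_F\ge 0$, $F\in\mathcal F$ (a set $I$ is independent iff $|I\cap F|\le k_F$ for all $F\in\mathcal F$), and let $k$ be its rank. - If $k\le d$, there is a $k^{2k}$-composable coreset of size at most $C\,k^{2k}$. - If $k\ge d$, there is a $d^{2d}$-composable coreset of size at most $C\,(kd)^k$. -/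

import Mathlib

/-! Determinant maximization under partition and laminar matroid constraints, and composable
coresets for it. The ground set is `Fin n`; element `i` carries the vector `v i`. -/

/-- An indexed family of finite sets is laminar if any two members are disjoint or nested. -/
def IsLaminarFamily {n t : ℕ} (F : Fin t → Finset (Fin n)) : Prop :=
  ∀ i j, Disjoint (F i) (F j) ∨ F i ⊆ F j ∨ F j ⊆ F i

/-- `P` partitions `Fin n`: every element lies in exactly one of the (possibly empty) parts. -/
def IsIndexedPartition {n s : ℕ} (P : Fin s → Finset (Fin n)) : Prop :=
  ∀ x, ∃! i, x ∈ P i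

theorem IsIndexedPartition.isLaminarFamily {n s : ℕ} {P : Fin s → Finset (Fin n)}
    (hP : IsIndexedPartition P) : IsLaminarFamily P := by
  intro i j
  by_cases h : Disjoint (P i) (P j)
  · exact Or.inl h
  · obtain ⟨x, hi, hj⟩ := Finset.not_disjoint_iff.1 h
    obtain rfl := (hP x).unique hi hj
    exact Or.inr (Or.inl subset_rfl)

/-- `I` satisfies all capacity constraints `|I ∩ F i| ≤ cap i`. -/
def CapIndep {n t : ℕ} (F : Fin t → Finset (Fin n)) (cap : Fin t → ℕ) (I : Finset (Fin n)) :
    Prop :=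
  ∀ i, (I ∩ F i).card ≤ cap i

/-- The augmentation property of the sets satisfying laminar capacity constraints. -/
theorem IsLaminarFamily.capIndep_aug {n t : ℕ} {F : Fin t → Finset (Fin n)}
    (hF : IsLaminarFamily F) {cap : Fin t → ℕ} {I J : Finset (Fin n)}
    (hI : CapIndep F cap I) (hJ : CapIndep F cap J) (hIJ : I.card < J.card) :
    ∃ e ∈ J, e ∉ I ∧ CapIndep F cap (insert e I) := by
  classical
  by_contra! hcon
  -- every element of `J \ I` lies in a tight set
  have htight : ∀ e ∈ J, e ∉ I → ∃ i, e ∈ F i ∧ (I ∩ F i).card = cap i := by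
    intro e heJ heI
    have h := hcon e heJ heI
    unfold CapIndep at h
    push Not at h
    obtain ⟨i, hi⟩ := h
    by_cases hei : e ∈ F i
    · refine ⟨i, hei, ?_⟩
      rw [Finset.insert_inter_of_mem hei] at hi
      have h1 := Finset.card_insert_le e (I ∩ F i)
      have h2 := hI i
      omega
    · rw [Finset.insert_inter_of_notMem hei] at hi
      exact absurd (hI i) (by omega)
  let T : Finset (Finset (Fin n)) :=
    (Finset.univ.filter fun i => (I ∩ F i).card = cap i).image F
  let D : Finset (Finset (Fin n)) := T.filter fun A => Maximal (· ∈ T) A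
  have hdisj : ∀ A ∈ D, ∀ B ∈ D, A ≠ B → Disjoint A B := by
    intro A hA B hB hAB
    obtain ⟨hAT, hAm⟩ := Finset.mem_filter.1 hA
    obtain ⟨hBT, hBm⟩ := Finset.mem_filter.1 hB
    obtain ⟨i, -, rfl⟩ := Finset.mem_image.1 hAT
    obtain ⟨j, -, rfl⟩ := Finset.mem_image.1 hBT
    rcases hF i j with h | h | h
    · exact h
    · exact absurd (hAm.eq_of_le hBT h) hAB
    · exact absurd (hBm.eq_of_le hAT h).symm hAB
  have hcover : ∀ e ∈ J, e ∉ I → e ∈ D.biUnion id := by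
    intro e heJ heI
    obtain ⟨i, hei, hi⟩ := htight e heJ heI
    have hiT : F i ∈ T := Finset.mem_image.2 ⟨i, by simp [hi], rfl⟩
    obtain ⟨B, hiB, hB⟩ := T.exists_le_maximal hiT
    exact Finset.mem_biUnion.2 ⟨B, Finset.mem_filter.2 ⟨hB.1, hB⟩, hiB hei⟩
  have hcard : ∀ K : Finset (Fin n),
      (K ∩ D.biUnion id).card = ∑ A ∈ D, (K ∩ A).card := by
    intro K
    rw [Finset.inter_biUnion, Finset.card_biUnion]
    · rfl
    · intro A hA B hB hAB
      exact (hdisj A hA B hB hAB).mono Finset.inter_subset_right Finset.inter_subset_right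
  have hle : (J ∩ D.biUnion id).card ≤ (I ∩ D.biUnion id).card := by
    rw [hcard, hcard]
    refine Finset.sum_le_sum fun A hA => ?_
    obtain ⟨i, hi, rfl⟩ := Finset.mem_image.1 (Finset.mem_filter.1 hA).1
    rw [(Finset.mem_filter.1 hi).2]
    exact hJ i
  have hout : (J \ D.biUnion id).card ≤ (I \ D.biUnion id).card := by
    refine Finset.card_le_card fun e he => ?_
    obtain ⟨heJ, heD⟩ := Finset.mem_sdiff.1 he
    refine Finset.mem_sdiff.2 ⟨?_, heD⟩
    by_contra heI
    exact heD (hcover e heJ heI)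
  have h1 := Finset.card_inter_add_card_sdiff J (D.biUnion id)
  have h2 := Finset.card_inter_add_card_sdiff I (D.biUnion id)
  omega

/-- The laminar matroid on `Fin n`: `I` is independent iff `|I ∩ F i| ≤ cap i` for all `i`. -/
def laminarMatroid {n t : ℕ} (F : Fin t → Finset (Fin n)) (hF : IsLaminarFamily F)
    (cap : Fin t → ℕ) : Matroid (Fin n) :=
  (IndepMatroid.ofFinset Set.univ (CapIndep F cap)
    (fun i => by simp)
    (fun _ _ hJ hIJ i => (Finset.card_le_card (Finset.inter_subset_inter_right hIJ)).trans (hJ i))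
    (fun _ _ hI hJ hIJ => hF.capIndep_aug hI hJ hIJ)
    (fun _ _ => Set.subset_univ _)).matroid

/-- The partition matroid: `I` is independent iff `|I ∩ P i| ≤ cap i` for every part `P i`. -/
def partitionMatroid {n s : ℕ} (P : Fin s → Finset (Fin n)) (hP : IsIndexedPartition P)
    (cap : Fin s → ℕ) : Matroid (Fin n) :=
  laminarMatroid P hP.isLaminarFamily cap

theorem laminarMatroid_indep_iff {n t : ℕ} (F : Fin t → Finset (Fin n)) (hF : IsLaminarFamily F)
    (cap : Fin t → ℕ) (I : Finset (Fin n)) :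
    (laminarMatroid F hF cap).Indep (I : Set (Fin n)) ↔ ∀ i, (I ∩ F i).card ≤ cap i := by
  rw [laminarMatroid, IndepMatroid.matroid_Indep]
  exact IndepMatroid.ofFinset_indep _ _ _ _ _ _

/-- The objective of determinant maximization. For `|S| ≤ d` it is the squared volume of the
parallelepiped spanned by the selected vectors, i.e. their Gram determinant (the `d × d` matrix
`∑ i ∈ S, v i (v i)ᵀ` is singular when `|S| < d`; for `|S| = d` the two determinants coincide).
For `|S| > d` it is `det (∑ i ∈ S, v i (v i)ᵀ)`. -/
noncomputable def detObjective {n d : ℕ} (v : Fin n → EuclideanSpace ℝ (Fin d))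
    (S : Finset (Fin n)) : ℝ :=
  if S.card ≤ d then (Matrix.gram ℝ fun i : S => v i).det
  else (∑ i ∈ S, Matrix.vecMulVec (v i).ofLp (v i).ofLp).det

/-- `c` is an `α`-composable coreset for maximizing `μ` over the bases of `M`: for every finite
collection `V 1, …, V m` of subsets of the ground set,
`α * max {μ T | T base, T ⊆ ⋃ c (V j)} ≥ max {μ S | S base, S ⊆ ⋃ V j}`,
where the first maximum is over a nonempty family whenever the second one is. -/
def IsComposableCoreset {n : ℕ} (M : Matroid (Fin n)) (μ : Finset (Fin n) → ℝ) (α : ℝ)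
    (c : Finset (Fin n) → Finset (Fin n)) : Prop :=
  (∀ V, c V ⊆ V) ∧
  ∀ (m : ℕ) (V : Fin m → Finset (Fin n)) (S : Finset (Fin n)),
    M.IsBase (S : Set (Fin n)) → S ⊆ Finset.univ.biUnion V →
    ∃ T : Finset (Fin n), M.IsBase (T : Set (Fin n)) ∧
      T ⊆ Finset.univ.biUnion (fun j => c (V j)) ∧ μ S ≤ α * μ T

/-- There is an `α`-composable coreset of size at most `b` for determinant maximization over the
bases of `M` with vectors in `ℝ^d`: to all input vectors `v` and all sets `V` it assigns a subset
`c v V` of `V`, computed from the vectors indexed by `V` only. -/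
def HasComposableCoreset {n : ℕ} (M : Matroid (Fin n)) (d : ℕ) (α : ℝ) (b : ℕ) : Prop :=
  ∃ c : (Fin n → EuclideanSpace ℝ (Fin d)) → Finset (Fin n) → Finset (Fin n),
    (∀ v w V, (∀ i ∈ V, v i = w i) → c v V = c w V) ∧
    ∀ v, IsComposableCoreset M (detObjective v) α (c v) ∧ ∀ V, (c v V).card ≤ b

/-! Composable coresets for determinant maximization over partition and laminar matroids.

The engine is the exchange of a single element. Let `S` be a base and `e ∈ S` an element of `V`
outside the coreset of `V`. If the coreset contains an element `u` for which `S \ {e} ∪ {u}` is a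
base and which is nearly as good as `e`, then `e` is replaced by `u`, and so on until the base lies
in the union of the coresets. How good an element is depends on `S` only through a seminorm of its
vector.

*Rank at most `d`.* The squared volume of `S` is that of `S \ {e}` times the square of the distance
of `v e` to the `(k - 1)`-dimensional span of `S \ {e}` (`det_gram_insert`). Let `Y ⊆ X` be a set
of at most `k` vectors, of maximal cardinality among the independent ones and then of maximal
volume. Writing `e = ∑ cᵢ uᵢ + q` with `uᵢ` in `Y` and `q` orthogonal to the span of `Y`,
maximality says `cᵢ² + ‖q‖² ‖yᵢ‖² ≤ 1` for the dual basis `y`. The vector `q` is handled by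
comparing two subspaces of equal dimension, for which the angles are symmetric, and Cauchy-Schwarz
then gives `dist(e, H) ≤ ∑ dist(uᵢ, H) ≤ k max dist(uᵢ, H)` for every subspace `H` of dimension
less than `k` (`distSeminorm_le_sum`). So each of the `k` exchanges loses a factor of at most
`k ^ 2`.

*Rank at least `d`.* By the matrix determinant lemma `det (A + x xᵀ) - det A` is the square of a
seminorm of `x`, and for `k = d` the above `Y` spans, with coefficients in `[-1, 1]`, so that some
`u` in `Y` has a seminorm at least `1 / d` times that of `e`. Losing `d ^ 2` in each of the `k`
exchanges would be too much, but if replaced elements are given weight `d ^ 2`, then the weighted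
determinant does not decrease, and the weights are removed at the end at the cost `(d ^ 2) ^ d`
(`isComposableCoreset_of_ge`).

*Which `u` can be used.* In a partition matroid, `u` must lie in the part of `e` and outside
`S \ {e}`. For rank at most `d` this is automatic if the volume is positive. For rank at least `d`
each part contributes several disjoint layers of spanners, one of which must offer a candidate
outside `S`. In a laminar matroid, `u` must avoid the at most `k - 1` disjoint maximal tight
members that do not contain `e`, and the other elements of `S \ {e}`. Such a blocking set is
determined by one of its elements and one capacity less than `k` (`exists_capBlock_eq_tightBlock`).
The coreset therefore collects spanners along a tree: at each node, for each `u` of the spanner and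
each capacity, the corresponding block is removed and a spanner of the rest is taken, to depth
`k - 1` (`exists_mem_spannerTree`). -/

section

open Matrix Module Submodule
open scoped InnerProductSpace

/-! ### Distances to subspaces and Gram determinants -/

section Geometry

variable {E : Type*} [NormedAddCommGroup E] [InnerProductSpace ℝ E] [FiniteDimensional ℝ E]

/-- The distance of a vector to the subspace `H`, as a seminorm. -/
noncomputable def distSeminorm (H : Submodule ℝ E) : Seminorm ℝ E :=
  (normSeminorm ℝ E).comp (Hᗮ.starProjection : E →ₗ[ℝ] E)

theorem distSeminorm_apply (H : Submodule ℝ E) (x : E) :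
    distSeminorm H x = ‖Hᗮ.starProjection x‖ := rfl

theorem distSeminorm_eq_zero_iff {H : Submodule ℝ E} {x : E} : distSeminorm H x = 0 ↔ x ∈ H := by
  rw [distSeminorm_apply, norm_eq_zero, starProjection_orthogonal_val, sub_eq_zero, eq_comm,
    starProjection_eq_self_iff]

theorem inner_starProjection_eq_inner {K : Submodule ℝ E} {z : E} (hz : z ∈ K) (x : E) :
    ⟪z, K.starProjection x⟫_ℝ = ⟪z, x⟫_ℝ := by
  rw [← inner_starProjection_left_eq_right, starProjection_eq_self_iff.2 hz]

theorem inner_starProjection_self (K : Submodule ℝ E) (x : E) :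
    ⟪K.starProjection x, x⟫_ℝ = ‖K.starProjection x‖ ^ 2 := by
  rw [← inner_starProjection_eq_inner (K.starProjection_apply_mem x), real_inner_self_eq_norm_sq]

theorem norm_sq_eq_starProjection_add_distSeminorm (H : Submodule ℝ E) (x : E) :
    ‖x‖ ^ 2 = ‖H.starProjection x‖ ^ 2 + distSeminorm H x ^ 2 :=
  norm_sq_eq_add_norm_sq_starProjection x H

/-- Bessel's inequality for the two orthogonal vectors `y` and `q` of `Hᗮ`, the second of which is
a projection of `x`, multiplied by `‖y‖ ^ 2`. -/
theorem inner_sq_add_inner_sq_le_distSeminorm {H : Submodule ℝ E} {y q x : E} (hy : y ∈ Hᗮ)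
    (hq : q ∈ Hᗮ) (hyq : ⟪y, q⟫_ℝ = 0) (hxq : ⟪q, x⟫_ℝ = ‖q‖ ^ 2) :
    ⟪y, x⟫_ℝ ^ 2 + ‖q‖ ^ 2 * ‖y‖ ^ 2 ≤ distSeminorm H x ^ 2 * ‖y‖ ^ 2 := by
  have h1 : ∀ z ∈ Hᗮ, ⟪z, Hᗮ.starProjection x⟫_ℝ = ⟪z, x⟫_ℝ := fun z hz =>
    inner_starProjection_eq_inner hz x
  rw [distSeminorm_apply]
  set p := Hᗮ.starProjection x
  have h2 : ⟪y, p - q⟫_ℝ = ⟪y, x⟫_ℝ := by rw [inner_sub_right, h1 y hy, hyq, sub_zero]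
  have h3 : ‖p - q‖ ^ 2 = ‖p‖ ^ 2 - ‖q‖ ^ 2 := by
    rw [norm_sub_sq_real, real_inner_comm, h1 q hq, hxq]; ring
  have h4 : ⟪y, p - q⟫_ℝ ^ 2 ≤ ‖y‖ ^ 2 * ‖p - q‖ ^ 2 := by
    rw [← mul_pow]
    exact sq_le_sq' (neg_le_of_abs_le (abs_real_inner_le_norm _ _)) (real_inner_le_norm _ _)
  rw [h2, h3] at h4
  linarith

/-- Base times height: adding `x` to the family `w` multiplies the squared volume by the square of
the distance of `x` to the span of `w`. -/
theorem det_gram_sumElim {ι : Type*} [Fintype ι] [DecidableEq ι] (w : ι → E) (x : E) :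
    (gram ℝ (Sum.elim w fun _ : Unit => x)).det =
      distSeminorm (span ℝ (Set.range w)) x ^ 2 * (gram ℝ w).det := by
  set K := span ℝ (Set.range w)
  obtain ⟨a, ha⟩ := (mem_span_range_iff_exists_fun ℝ).1 (K.starProjection_apply_mem x)
  set q := Kᗮ.starProjection x with hq
  have hqw : ∀ i, ⟪q, w i⟫_ℝ = 0 := fun i =>
    (mem_orthogonal' K q).1 (Kᗮ.starProjection_apply_mem x) _ (subset_span ⟨i, rfl⟩)
  have hwq : ∀ i, ⟪w i, q⟫_ℝ = 0 := fun i => by rw [real_inner_comm, hqw]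
  have hx : x = ∑ i, a i • w i + q := by
    rw [ha, hq, starProjection_orthogonal_val]; abel
  let N : Matrix (ι ⊕ Unit) (ι ⊕ Unit) ℝ := fromBlocks 1 (of fun i _ => a i) 0 1
  have hN : N.det = 1 := by simp [N]
  -- subtracting from `x` its projection is a unipotent change of the family
  have key : gram ℝ (Sum.elim w fun _ : Unit => x) =
      Nᵀ * fromBlocks (gram ℝ w) 0 0 (of fun _ _ => ‖q‖ ^ 2) * N := by
    simp only [N, fromBlocks_transpose, fromBlocks_multiply]
    ext (i | i) (j | j)
    · simp
    · simp [mul_apply, hx, inner_add_right, inner_sum, inner_smul_right, hwq, mul_comm]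
    · simp [mul_apply, hx, inner_add_left, sum_inner, inner_smul_left, hqw]
    · have h1 := star_dotProduct_gram_mulVec (𝕜 := ℝ) w a a
      have h2 := norm_sq_eq_add_norm_sq_starProjection x K
      rw [ha, real_inner_self_eq_norm_sq] at h1
      rw [← h1] at h2
      simp only [gram_apply, Sum.elim_inr, real_inner_self_eq_norm_sq, h2]
      simp [mul_apply, dotProduct, mulVec, q]
      simp only [Finset.mul_sum, Finset.sum_mul, mul_assoc]
      exact Finset.sum_comm
  rw [key, det_mul, det_mul, det_transpose, hN, det_fromBlocks_zero₂₁, distSeminorm_apply]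
  simp [q, mul_comm]

/-- Let `t ⊥ L` and `w` be unit vectors, so that the sine of the angle between `w` and `L` is at
least `|⟪w, t⟫|`. If `finrank H < finrank L`, then some vector of `L` has at least this sine with
`H ⊔ span {w}`. It is a vector which the projection to `H ⊔ span {w}` maps to zero or to `w`. -/
theorem exists_mem_abs_inner_mul_norm_le {L H : Submodule ℝ E} {w t : E} (hw : ‖w‖ = 1)
    (ht : ‖t‖ = 1) (htL : t ∈ Lᗮ) (hH : finrank ℝ H < finrank ℝ L) :
    ∃ l ∈ L, l ≠ 0 ∧ |⟪w, t⟫_ℝ| * ‖l‖ ≤ distSeminorm (H ⊔ span ℝ {w}) l := by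
  set H' := H ⊔ span ℝ {w}
  have hwH : w ∈ H' := mem_sup_right (mem_span_singleton_self w)
  have hdim : finrank ℝ H' ≤ finrank ℝ L := by
    have h1 := finrank_add_le_finrank_add_finrank H (span ℝ {w})
    have h2 := finrank_span_le_card (R := ℝ) ({w} : Set E)
    simp only [Set.toFinset_singleton, Finset.card_singleton] at h2
    have h3 : finrank ℝ H' ≤ finrank ℝ H + finrank ℝ (span ℝ {w}) := h1
    omega
  let T : L →ₗ[ℝ] H' := (H'.orthogonalProjectionOnto : E →ₗ[ℝ] H') ∘ₗ L.subtype
  have hT : ∀ l : L, (T l : E) = H'.starProjection l := fun l => rfl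
  by_cases hinj : Function.Injective T
  · have hdim' : finrank ℝ L = finrank ℝ H' :=
      le_antisymm (LinearMap.finrank_le_finrank_of_injective hinj) hdim
    obtain ⟨l, hl⟩ :=
      (LinearMap.injective_iff_surjective_of_finrank_eq_finrank hdim').1 hinj ⟨w, hwH⟩
    have hl' : H'.starProjection (l : E) = w := by rw [← hT, hl]
    refine ⟨l, l.2, ?_, ?_⟩
    · intro h0
      rw [h0, map_zero] at hl'
      rw [← hl', norm_zero] at hw
      exact zero_ne_one hw
    · have h1 : ⟪L.starProjection w, (l : E)⟫_ℝ = 1 := by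
        rw [inner_starProjection_left_eq_right, starProjection_eq_self_iff.2 l.2,
          ← starProjection_eq_self_iff.2 hwH, inner_starProjection_left_eq_right, hl',
          real_inner_self_eq_norm_sq, hw, one_pow]
      have h2 : 1 ≤ ‖L.starProjection w‖ * ‖(l : E)‖ := h1 ▸ real_inner_le_norm _ _
      have h3 := norm_sq_eq_starProjection_add_distSeminorm L w
      have h4 := norm_sq_eq_starProjection_add_distSeminorm H' (l : E)
      have h5 : |⟪w, t⟫_ℝ| ≤ distSeminorm L w := by
        rw [← starProjection_eq_self_iff.2 htL, ← inner_starProjection_left_eq_right]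
        exact (abs_real_inner_le_norm _ _).trans (by rw [ht, mul_one, distSeminorm_apply])
      rw [hw] at h3
      rw [hl', hw] at h4
      refine le_of_sq_le_sq ?_ (apply_nonneg _ _)
      have h6 : |⟪w, t⟫_ℝ| ^ 2 ≤ distSeminorm L w ^ 2 := pow_le_pow_left₀ (abs_nonneg _) h5 2
      have h7 : 1 ≤ ‖L.starProjection w‖ ^ 2 * ‖(l : E)‖ ^ 2 := by
        rw [← mul_pow]; exact one_le_pow₀ h2
      rw [mul_pow]
      nlinarith [sq_nonneg ‖(l : E)‖]
  · obtain ⟨l, hl, hl0⟩ : ∃ l, T l = 0 ∧ l ≠ 0 := by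
      by_contra! h
      exact hinj ((injective_iff_map_eq_zero T).2 h)
    refine ⟨l, l.2, by simpa using hl0, ?_⟩
    have h4 := norm_sq_eq_starProjection_add_distSeminorm H' (l : E)
    rw [← hT, hl] at h4
    simp only [ZeroMemClass.coe_zero, norm_zero] at h4
    have h5 : ‖(l : E)‖ = distSeminorm H' (l : E) := by
      refine (sq_eq_sq₀ (norm_nonneg _) (apply_nonneg _ _)).1 (by linarith)
    rw [← h5]
    have h6 := abs_real_inner_le_norm w t
    rw [hw, ht, one_mul] at h6
    exact mul_le_of_le_one_left (norm_nonneg _) h6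

/-- Pythagoras for enlarging `H` by a unit vector `w ⊥ H`. -/
theorem inner_sq_add_distSeminorm_sup_sq_le {H : Submodule ℝ E} {w : E} (hw : ‖w‖ = 1)
    (hwH : w ∈ Hᗮ) (x : E) :
    ⟪w, x⟫_ℝ ^ 2 + distSeminorm (H ⊔ span ℝ {w}) x ^ 2 ≤ distSeminorm H x ^ 2 := by
  set H' := H ⊔ span ℝ {w}
  have h1 := inner_sq_add_inner_sq_le_distSeminorm (H := H) (y := w) (q := H'ᗮ.starProjection x)
    (x := x) hwH (orthogonal_le le_sup_left (H'ᗮ.starProjection_apply_mem x))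
    ((mem_orthogonal H' _).1 (H'ᗮ.starProjection_apply_mem x) _
      (mem_sup_right (mem_span_singleton_self w))) ?_
  · rwa [hw, one_pow, mul_one, mul_one] at h1
  · exact inner_starProjection_self _ _

omit [FiniteDimensional ℝ E] in
/-- A vector whose coefficients in `u` lie in `[-1, 1]` is dominated by `u` in every seminorm. -/
theorem seminorm_le_sum_of_abs_inner_le_one {ι : Type*} [Fintype ι] {u y : ι → E} {e : E}
    (N : Seminorm ℝ E) (hrep : ∑ i, ⟪y i, e⟫_ℝ • u i = e) (hc : ∀ i, |⟪y i, e⟫_ℝ| ≤ 1) :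
    N e ≤ ∑ i, N (u i) := by
  rw [← hrep]
  refine (Finset.le_sum_of_subadditive N (map_zero N).le (map_add_le_add N) _ _).trans
    (Finset.sum_le_sum fun i _ => ?_)
  rw [map_smul_eq_mul, Real.norm_eq_abs]
  exact mul_le_of_le_one_left (apply_nonneg _ _) (hc i)

/-- Let `y` be the basis of `L` dual to the basis `u`. If replacing any `u i` by `e` does not
increase the volume of `u` (the hypothesis `hc`, in which the left-hand side is the factor by which
the squared volume changes), then the distances of the `u i` to a subspace `H` of smaller dimension
than `L` add up to at least the distance of `e` to `H`. The part of `e` orthogonal to `L` is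
controlled by `exists_mem_abs_inner_mul_norm_le`. -/
theorem distSeminorm_le_sum {ι : Type*} [Fintype ι] {u y : ι → E} {L H : Submodule ℝ E}
    (hrep : ∀ l ∈ L, ∑ i, ⟪y i, l⟫_ℝ • u i = l) (hyL : ∀ i, y i ∈ L) {e : E}
    (hc : ∀ i, ⟪y i, e⟫_ℝ ^ 2 + distSeminorm L e ^ 2 * ‖y i‖ ^ 2 ≤ 1)
    (hH : finrank ℝ H < finrank ℝ L) :
    distSeminorm H e ≤ ∑ i, distSeminorm H (u i) := by
  by_cases hq0 : distSeminorm L e = 0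
  · have heL : e ∈ L := distSeminorm_eq_zero_iff.1 hq0
    refine seminorm_le_sum_of_abs_inner_le_one _ (hrep e heL) fun i => ?_
    have := hc i
    rw [hq0] at this
    exact (sq_le_one_iff_abs_le_one _).1 (by linarith)
  by_cases he0 : distSeminorm H e = 0
  · rw [he0]
    exact Finset.sum_nonneg fun _ _ => apply_nonneg _ _
  set r := distSeminorm L e with hr
  set p := Hᗮ.starProjection e with hp
  have hpH : p ∈ Hᗮ := Hᗮ.starProjection_apply_mem e
  have hp0 : ‖p‖ ≠ 0 := he0
  set q := Lᗮ.starProjection e with hq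
  have hqL : q ∈ Lᗮ := Lᗮ.starProjection_apply_mem e
  have hqr : ‖q‖ = r := rfl
  set w := ‖p‖⁻¹ • p with hw
  have hw1 : ‖w‖ = 1 := by
    rw [hw, norm_smul, norm_inv, norm_norm, inv_mul_cancel₀ hp0]
  have hwH : w ∈ Hᗮ := Hᗮ.smul_mem _ hpH
  have hwe : ⟪w, e⟫_ℝ = distSeminorm H e := by
    rw [hw, real_inner_smul_left, inner_starProjection_self, distSeminorm_apply, ← hp]
    field_simp
  have ht1 : ‖r⁻¹ • q‖ = 1 := by
    rw [norm_smul, norm_inv, Real.norm_eq_abs, abs_of_nonneg (apply_nonneg _ _), hqr,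
      inv_mul_cancel₀ hq0]
  obtain ⟨l, hl, hl0, hlt⟩ :=
    exists_mem_abs_inner_mul_norm_le hw1 ht1 (Lᗮ.smul_mem _ hqL) hH
  set H' := H ⊔ span ℝ {w}
  -- expanding `l` in the basis `u` bounds `⟪w, q⟫` by the distances of the `u i` to `H'`
  have hwq : |⟪w, q⟫_ℝ| ≤ ∑ i, r * (‖y i‖ * distSeminorm H' (u i)) := by
    have h1 : distSeminorm H' l ≤ ∑ i, ‖l‖ * (‖y i‖ * distSeminorm H' (u i)) := by
      conv_lhs => rw [← hrep l hl]
      refine (Finset.le_sum_of_subadditive _ (map_zero _).le (map_add_le_add _) _ _).trans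
        (Finset.sum_le_sum fun i _ => ?_)
      rw [map_smul_eq_mul, Real.norm_eq_abs, ← mul_assoc]
      refine mul_le_mul_of_nonneg_right ?_ (apply_nonneg _ _)
      rw [mul_comm]
      exact abs_real_inner_le_norm _ _
    have h2 := hlt.trans h1
    rw [← Finset.mul_sum, mul_comm] at h2
    have h3 := le_of_mul_le_mul_left h2 (norm_pos_iff.2 hl0)
    have hr0 : 0 < r := lt_of_le_of_ne (apply_nonneg _ _) (Ne.symm hq0)
    rw [real_inner_smul_right, abs_mul, abs_inv, abs_of_pos hr0, inv_mul_le_iff₀ hr0] at h3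
    rwa [← Finset.mul_sum]
  have hsum : e = ∑ i, ⟪y i, e⟫_ℝ • u i + q := by
    have h1 : ∀ i, ⟪y i, L.starProjection e⟫_ℝ = ⟪y i, e⟫_ℝ := fun i =>
      inner_starProjection_eq_inner (hyL i) e
    have h2 := hrep _ (L.starProjection_apply_mem e)
    simp only [h1] at h2
    rw [h2, hq, starProjection_orthogonal_val]
    abel
  have hwe' : ⟪w, e⟫_ℝ = ∑ i, ⟪y i, e⟫_ℝ * ⟪w, u i⟫_ℝ + ⟪w, q⟫_ℝ := by
    conv_lhs => rw [hsum]
    rw [inner_add_right, inner_sum]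
    simp only [real_inner_smul_right]
  rw [← hwe, hwe']
  calc _ ≤ ∑ i, ⟪y i, e⟫_ℝ * ⟪w, u i⟫_ℝ + ∑ i, r * (‖y i‖ * distSeminorm H' (u i)) := by
        gcongr
        exact (le_abs_self _).trans hwq
    _ = ∑ i, (⟪y i, e⟫_ℝ * ⟪w, u i⟫_ℝ + r * (‖y i‖ * distSeminorm H' (u i))) :=
        Finset.sum_add_distrib.symm
    _ ≤ _ := Finset.sum_le_sum fun i _ => ?_
  -- Cauchy-Schwarz in the plane
  refine le_of_sq_le_sq ?_ (apply_nonneg _ _)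
  have h1 := inner_sq_add_distSeminorm_sup_sq_le hw1 hwH (u i)
  have h2 := hc i
  have h3 : 0 ≤ ⟪w, u i⟫_ℝ ^ 2 + distSeminorm H' (u i) ^ 2 := by positivity
  nlinarith [sq_nonneg (⟪y i, e⟫_ℝ * distSeminorm H' (u i) - r * ‖y i‖ * ⟪w, u i⟫_ℝ),
    mul_le_mul_of_nonneg_right h2 h3]

/-- A linearly independent family has a dual basis `y` in its span, and the volume condition of
`distSeminorm_le_sum` at `i` holds once `e` is not farther than `u i` from the span of the others.
Here `y i` is the component of `u i` orthogonal to the others, divided by its squared norm. -/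
theorem exists_dual_family {ι : Type*} [Fintype ι] [DecidableEq ι] {u : ι → E}
    (hu : LinearIndependent ℝ u) : ∃ y : ι → E,
      (∀ l ∈ span ℝ (Set.range u), ∑ i, ⟪y i, l⟫_ℝ • u i = l) ∧
      (∀ i, y i ∈ span ℝ (Set.range u)) ∧
      ∀ e i, distSeminorm (span ℝ (u '' {i}ᶜ)) e ≤ distSeminorm (span ℝ (u '' {i}ᶜ)) (u i) →
        ⟪y i, e⟫_ℝ ^ 2 + distSeminorm (span ℝ (Set.range u)) e ^ 2 * ‖y i‖ ^ 2 ≤ 1 := by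
  set L := span ℝ (Set.range u)
  let K : ι → Submodule ℝ E := fun i => span ℝ (u '' {i}ᶜ)
  let z : ι → E := fun i => (K i)ᗮ.starProjection (u i)
  have hKL : ∀ i, K i ≤ L := fun i => span_mono (Set.image_subset_range _ _)
  have hzK : ∀ i, z i ∈ (K i)ᗮ := fun i => (K i)ᗮ.starProjection_apply_mem _
  have hz0 : ∀ i, ‖z i‖ ≠ 0 := fun i h =>
    hu.notMem_span_image (s := {i}ᶜ) (x := i) (by simp) (distSeminorm_eq_zero_iff.1 h)
  have hzu : ∀ i, ⟪z i, u i⟫_ℝ = ‖z i‖ ^ 2 := fun i => inner_starProjection_self _ _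
  have hzL : ∀ i, z i ∈ L := fun i => by
    rw [show z i = u i - (K i).starProjection (u i) from starProjection_orthogonal_val _]
    exact L.sub_mem (subset_span ⟨i, rfl⟩) (hKL i ((K i).starProjection_apply_mem _))
  let y : ι → E := fun i => (‖z i‖ ^ 2)⁻¹ • z i
  have hyu : ∀ i j, ⟪y i, u j⟫_ℝ = if i = j then 1 else 0 := fun i j => by
    rw [real_inner_smul_left]
    split_ifs with h
    · subst h
      rw [hzu, inv_mul_cancel₀ (pow_ne_zero 2 (hz0 i))]
    · rw [(mem_orthogonal' _ _).1 (hzK i) (u j) (subset_span ⟨j, fun hj => h hj.symm, rfl⟩),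
        mul_zero]
  refine ⟨y, fun l hl => ?_, fun i => L.smul_mem _ (hzL i), fun e i h => ?_⟩
  · obtain ⟨a, rfl⟩ := (mem_span_range_iff_exists_fun ℝ).1 hl
    refine Finset.sum_congr rfl fun i _ => ?_
    simp [inner_sum, real_inner_smul_right, hyu]
  · set q := Lᗮ.starProjection e
    have hqL : q ∈ Lᗮ := Lᗮ.starProjection_apply_mem e
    have h1 := inner_sq_add_inner_sq_le_distSeminorm (x := e) (hzK i) (orthogonal_le (hKL i) hqL)
      ((mem_orthogonal _ _).1 hqL _ (hzL i)) (inner_starProjection_self _ _)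
    have h2 : distSeminorm (K i) e ^ 2 ≤ ‖z i‖ ^ 2 :=
      pow_le_pow_left₀ (apply_nonneg _ _) h 2
    have h3 : 0 < ‖z i‖ ^ 2 := by have := hz0 i; positivity
    have h4 : ‖y i‖ ^ 2 = (‖z i‖ ^ 2)⁻¹ := by
      rw [norm_smul, norm_inv, norm_pow, norm_norm]
      field_simp
    rw [h4, real_inner_smul_left, distSeminorm_apply]
    rw [mul_pow, ← div_eq_mul_inv, inv_pow, inv_mul_eq_div]
    change ⟪z i, e⟫_ℝ ^ 2 / (‖z i‖ ^ 2) ^ 2 + ‖q‖ ^ 2 / ‖z i‖ ^ 2 ≤ 1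
    rw [show ⟪z i, e⟫_ℝ ^ 2 / (‖z i‖ ^ 2) ^ 2 + ‖q‖ ^ 2 / ‖z i‖ ^ 2 =
      (⟪z i, e⟫_ℝ ^ 2 + ‖q‖ ^ 2 * ‖z i‖ ^ 2) / (‖z i‖ ^ 2) ^ 2 by field_simp,
      div_le_one (by positivity)]
    nlinarith
end Geometry

/-! ### Spanners of maximal volume -/

section Spanner

variable {E : Type*} [NormedAddCommGroup E] [InnerProductSpace ℝ E]
variable {α : Type*} [DecidableEq α]

/-- `Y ⊆ X` spans `X` up to the factor `κ`, as seen by the seminorms in `𝒢`. -/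
def IsSpanner (𝒢 : Set (Seminorm ℝ E)) (κ : ℝ) (v : α → E) (X Y : Finset α) : Prop :=
  Y ⊆ X ∧ ∀ N ∈ 𝒢, ∀ e ∈ X, ∃ u ∈ Y, N (v e) ≤ κ * N (v u)

omit [DecidableEq α] in
theorem exists_isSpanner_of_le_sum {𝒢 : Set (Seminorm ℝ E)} {v : α → E} {X Y : Finset α} {k : ℕ}
    (hk : 1 ≤ k) (hYX : Y ⊆ X) (hYk : Y.card ≤ k)
    (h : ∀ N ∈ 𝒢, ∀ e ∈ X, N (v e) ≤ ∑ u ∈ Y, N (v u)) :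
    ∃ Z, Z.card ≤ k ∧ IsSpanner 𝒢 k v X Z := by
  rcases Y.eq_empty_or_nonempty with rfl | hY
  · rcases X.eq_empty_or_nonempty with rfl | ⟨x, hx⟩
    · exact ⟨∅, by simp, subset_rfl, by simp⟩
    · refine ⟨{x}, by simpa using hk, by simpa using hx, fun N hN e he =>
        ⟨x, Finset.mem_singleton_self x, ?_⟩⟩
      have := h N hN e he
      rw [Finset.sum_empty] at this
      exact this.trans (mul_nonneg (Nat.cast_nonneg k) (apply_nonneg _ _))
  · refine ⟨Y, hYk, hYX, fun N hN e he => ?_⟩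
    obtain ⟨u, hu, hmax⟩ := Y.exists_max_image (fun u => N (v u)) hY
    refine ⟨u, hu, (h N hN e he).trans ((Finset.sum_le_card_nsmul _ _ _ hmax).trans ?_)⟩
    rw [nsmul_eq_mul]
    exact mul_le_mul_of_nonneg_right (by exact_mod_cast hYk) (apply_nonneg _ _)

variable [FiniteDimensional ℝ E]

theorem det_gram_insert (v : α → E) {S : Finset α} {x : α} (hx : x ∉ S) :
    (gram ℝ fun i : ↥(insert x S) => v i).det =
      distSeminorm (span ℝ (v '' S)) (v x) ^ 2 * (gram ℝ fun i : S => v i).det := by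
  let f : S ⊕ Unit ≃ ↥(insert x S) :=
    (Equiv.optionEquivSumPUnit.{0} S).symm.trans (Finset.subtypeInsertEquivOption hx).symm
  have h := det_gram_sumElim (fun i : S => v i) (v x)
  have h1 : v '' S = Set.range fun i : S => v i := Set.image_eq_range v S
  rw [h1, ← h, ← det_submatrix_equiv_self f]
  congr 1
  ext (i | i) (j | j) <;> simp [f, Finset.subtypeInsertEquivOption]

/-- The set `Y` is one of at most `k` linearly independent vectors, of the largest possible
cardinality and then of the largest possible volume. -/
theorem exists_max_volume (v : α → E) (X : Finset α) (k : ℕ) :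
    ∃ Y ⊆ X, Y.card ≤ k ∧ LinearIndependent ℝ (fun i : Y => v i) ∧
      (Y.card = k ∨ ∀ e ∈ X, v e ∈ span ℝ (v '' Y)) ∧
      ∀ e ∈ X, ∀ i ∈ Y, distSeminorm (span ℝ (v '' (Y.erase i))) (v e) ≤
        distSeminorm (span ℝ (v '' (Y.erase i))) (v i) := by
  classical
  let 𝒴 := X.powerset.filter fun Y : Finset α => Y.card ≤ k ∧ LinearIndependent ℝ (fun i : Y => v i)
  obtain ⟨Z, hZ, hZmax⟩ := 𝒴.exists_max_image Finset.card
    ⟨∅, by simp [𝒴]⟩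
  simp only [𝒴, Finset.mem_filter, Finset.mem_powerset] at hZ hZmax
  obtain ⟨hZX, hZk, hZli⟩ := hZ
  obtain ⟨Y, hY, hYmax⟩ := (X.powersetCard Z.card).exists_max_image
    (fun Y : Finset α => (gram ℝ fun i : Y => v i).det) ⟨Z, Finset.mem_powersetCard.2 ⟨hZX, rfl⟩⟩
  obtain ⟨hYX, hYc⟩ := Finset.mem_powersetCard.1 hY
  have hpos : ∀ W : Finset α, 0 ≤ (gram ℝ fun i : W => v i).det := fun W =>
    (posSemidef_gram ℝ _).det_nonneg
  have hYpos : 0 < (gram ℝ fun i : Y => v i).det := by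
    refine lt_of_lt_of_le ?_ (hYmax Z (Finset.mem_powersetCard.2 ⟨hZX, rfl⟩))
    exact (hpos Z).lt_of_ne' (det_gram_ne_zero_iff_linearIndependent.2 hZli)
  have hYli : LinearIndependent ℝ (fun i : Y => v i) :=
    det_gram_ne_zero_iff_linearIndependent.1 hYpos.ne'
  refine ⟨Y, hYX, hYc.trans_le hZk, hYli, ?_, fun e he i hi => ?_⟩
  · by_contra! hcon
    obtain ⟨hk, e, he, hespan⟩ := hcon
    have heY : e ∉ Y := fun h => hespan (subset_span ⟨e, h, rfl⟩)
    have hli : LinearIndependent ℝ (fun i : ↥(insert e Y) => v i) := by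
      rw [← det_gram_ne_zero_iff_linearIndependent, det_gram_insert v heY]
      refine mul_ne_zero (pow_ne_zero 2 fun h0 => hespan ?_) hYpos.ne'
      exact distSeminorm_eq_zero_iff.1 h0
    have h1 := hZmax (insert e Y) ⟨Finset.insert_subset he hYX, by
      rw [Finset.card_insert_of_notMem heY]; omega, hli⟩
    rw [Finset.card_insert_of_notMem heY] at h1
    omega
  · by_cases heI : e ∈ Y.erase i
    · rw [distSeminorm_eq_zero_iff.2 (subset_span (Set.mem_image_of_mem v (Finset.mem_coe.2 heI)))]
      exact apply_nonneg _ _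
    · have h1 := det_gram_insert v (Finset.notMem_erase i Y)
      have h2 := det_gram_insert v heI
      have h3 := hYmax (insert e (Y.erase i)) (Finset.mem_powersetCard.2
        ⟨Finset.insert_subset he ((Finset.erase_subset _ _).trans hYX), by
          rw [Finset.card_insert_of_notMem heI, Finset.card_erase_add_one hi, hYc]⟩)
      rw [Finset.insert_erase hi] at h1
      rw [h1, h2] at h3
      rw [h1] at hYpos
      have h4 := pos_of_mul_pos_right hYpos (sq_nonneg _)
      exact le_of_sq_le_sq (le_of_mul_le_mul_right h3 h4) (apply_nonneg _ _)

/-- The dual form of `exists_max_volume`: replacing a vector of `Y` by any vector of `X` does not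
increase the volume. -/
theorem exists_dual_max_volume (v : α → E) (X : Finset α) (k : ℕ) :
    ∃ Y ⊆ X, Y.card ≤ k ∧ (Y.card = k ∨ ∀ e ∈ X, v e ∈ span ℝ (v '' Y)) ∧
      finrank ℝ (span ℝ (v '' Y)) = Y.card ∧ ∃ y : Y → E, (∀ i, y i ∈ span ℝ (v '' Y)) ∧
      (∀ l ∈ span ℝ (v '' Y), ∑ i, ⟪y i, l⟫_ℝ • v i = l) ∧
      ∀ e ∈ X, ∀ i,
        ⟪y i, v e⟫_ℝ ^ 2 + distSeminorm (span ℝ (v '' Y)) (v e) ^ 2 * ‖y i‖ ^ 2 ≤ 1 := by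
  obtain ⟨Y, hYX, hYk, hli, hspan, hmax⟩ := exists_max_volume v X k
  obtain ⟨y, hrep, hyL, hy⟩ := exists_dual_family hli
  have h1 : v '' Y = Set.range fun i : Y => v i := Set.image_eq_range v Y
  refine ⟨Y, hYX, hYk, hspan, ?_, y, ?_⟩
  · rw [h1, finrank_span_eq_card hli, Fintype.card_coe]
  · rw [h1]
    refine ⟨hyL, hrep, fun e he i => hy (v e) i ?_⟩
    have h2 : (fun i : Y => v i) '' {i}ᶜ = v '' (Y.erase i) := by
      ext z
      simp only [Set.mem_image, Set.mem_compl_iff, Set.mem_singleton_iff, Finset.coe_erase,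
        Set.mem_sdiff, Finset.mem_coe]
      constructor
      · rintro ⟨j, hj, rfl⟩
        exact ⟨j, ⟨j.2, fun h => hj (Subtype.ext h)⟩, rfl⟩
      · rintro ⟨j, ⟨hjY, hj⟩, rfl⟩
        exact ⟨⟨j, hjY⟩, fun h => hj (congrArg Subtype.val h), rfl⟩
    rw [h2]
    exact hmax e he i i.2

/-- At most `k` vectors suffice to span, up to the factor `k`, for the distances to all subspaces
of dimension less than `k`, whatever the dimension of the ambient space. -/
theorem exists_isSpanner_dist (v : α → E) (X : Finset α) {k : ℕ} (hk : 1 ≤ k) :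
    ∃ Y, Y.card ≤ k ∧
      IsSpanner {N | ∃ H : Submodule ℝ E, finrank ℝ H < k ∧ N = distSeminorm H} k v X Y := by
  obtain ⟨Y, hYX, hYk, hspan, hfin, y, hyL, hrep, hy⟩ := exists_dual_max_volume v X k
  refine exists_isSpanner_of_le_sum hk hYX hYk ?_
  rintro _ ⟨H, hH, rfl⟩ e he
  rw [← Finset.sum_coe_sort Y fun u => distSeminorm H (v u)]
  rcases hspan with h | h
  · exact distSeminorm_le_sum hrep hyL (hy e he) (by omega)
  · refine seminorm_le_sum_of_abs_inner_le_one _ (hrep _ (h e he)) fun i => ?_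
    rw [← sq_le_one_iff_abs_le_one]
    exact le_of_add_le_of_nonneg_left (hy e he i) (by positivity)

/-- In dimension `d`, at most `d` vectors suffice to span up to the factor `d` for all seminorms. -/
theorem exists_isSpanner_univ (v : α → E) (X : Finset α) (hE : 1 ≤ finrank ℝ E) :
    ∃ Y, Y.card ≤ finrank ℝ E ∧ IsSpanner Set.univ (finrank ℝ E) v X Y := by
  obtain ⟨Y, hYX, hYk, hspan, hfin, y, hyL, hrep, hy⟩ := exists_dual_max_volume v X (finrank ℝ E)
  refine exists_isSpanner_of_le_sum hE hYX hYk fun N _ e he => ?_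
  rw [← Finset.sum_coe_sort Y fun u => N (v u)]
  have hmem : v e ∈ span ℝ (v '' Y) := by
    rcases hspan with h | h
    · rw [eq_top_of_finrank_eq (hfin.trans h)]
      exact mem_top
    · exact h e he
  refine seminorm_le_sum_of_abs_inner_le_one _ (hrep _ hmem) fun i => ?_
  rw [← sq_le_one_iff_abs_le_one]
  exact le_of_add_le_of_nonneg_left (hy e he i) (by positivity)
end Spanner

/-! ### Determinants of weighted sums of rank-one matrices -/

section Weighted

variable {d n : ℕ}

open scoped MatrixOrder in
/-- The matrix determinant lemma for a positive semidefinite, possibly singular matrix: adding a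
multiple of `x xᵀ` increases the determinant by the same multiple of the square of a seminorm of
`x`, namely of `x ↦ ‖adj(B) x‖` where `A = B Bᵀ`. -/
theorem exists_seminorm_det_add_smul_vecMulVec {A : Matrix (Fin d) (Fin d) ℝ} (hA : A.PosSemidef) :
    ∃ N : Seminorm ℝ (EuclideanSpace ℝ (Fin d)), ∀ (x : EuclideanSpace ℝ (Fin d)) (t : ℝ),
      (A + t • vecMulVec x.ofLp x.ofLp).det = A.det + t * N x ^ 2 := by
  obtain ⟨B, hB⟩ : ∃ B : Matrix (Fin d) (Fin d) ℝ, A = B * Bᵀ := by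
    refine ⟨CFC.sqrt A, ?_⟩
    have h := (CFC.sqrt_nonneg A).posSemidef.1
    rw [← conjTranspose_eq_transpose_of_trivial, h.eq, CFC.sqrt_mul_sqrt_self A hA.nonneg]
  -- the identity with the adjugate, by continuity from the case of an invertible matrix
  have hadj : ∀ (x : Fin d → ℝ) (t : ℝ),
      (A + t • vecMulVec x x).det = A.det + t * (x ⬝ᵥ A.adjugate *ᵥ x) := by
    intro x t
    let f : ℝ → ℝ := fun ε => (A + ε • 1 + t • vecMulVec x x).det
    let g : ℝ → ℝ := fun ε => (A + ε • 1).det + t * (x ⬝ᵥ (A + ε • 1).adjugate *ᵥ x)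
    have hf : Continuous f := by fun_prop
    have hg : Continuous g := by fun_prop
    have hfg : ∀ ε ∈ Set.Ioi (0 : ℝ), f ε = g ε := by
      intro ε hε
      have hpd : (A + ε • (1 : Matrix (Fin d) (Fin d) ℝ)).PosDef :=
        PosDef.posSemidef_add hA (PosDef.one.smul hε)
      have hu : IsUnit (A + ε • (1 : Matrix (Fin d) (Fin d) ℝ)).det := hpd.det_pos.ne'.isUnit
      have h1 := det_add_replicateCol_mul_replicateRow (ι := Unit) hu (t • x) x
      have h2 : replicateCol Unit (t • x) * replicateRow Unit x = t • vecMulVec x x := by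
        rw [← vecMulVec_eq, smul_vecMulVec]
      rw [h2] at h1
      simp only [f, g]
      have h3 : ∀ M : Matrix (Fin d) (Fin d) ℝ, (replicateRow Unit x * M *
          replicateCol Unit (t • x)) default default = t * (x ⬝ᵥ M *ᵥ x) := fun M => by
        rw [Matrix.mul_assoc, ← replicateCol_mulVec, replicateRow_mul_replicateCol_apply,
          mulVec_smul, dotProduct_smul, smul_eq_mul]
      rw [h1, det_unique (n := Unit), Matrix.add_apply, one_apply_eq, h3, inv_def, smul_mulVec,
        dotProduct_smul, smul_eq_mul, mul_add, mul_one, mul_left_comm t, ← mul_assoc,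
        Ring.mul_inverse_cancel _ hu, one_mul]
    have h0 : (0 : ℝ) ∈ closure (Set.Ioi (0 : ℝ)) := by rw [closure_Ioi]; exact Set.self_mem_Ici
    have := Set.EqOn.closure (f := f) (g := g) hfg hf hg h0
    simpa [f, g] using this
  let φ : EuclideanSpace ℝ (Fin d) →ₗ[ℝ] EuclideanSpace ℝ (Fin d) := toEuclideanLin (B.adjugate)
  refine ⟨(normSeminorm ℝ _).comp φ, fun x t => ?_⟩
  rw [hadj, hB, adjugate_mul_distrib, ← adjugate_transpose, ← mulVec_mulVec, dotProduct_mulVec,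
    vecMul_transpose]
  congr 2
  change _ = ‖φ x‖ ^ 2
  rw [EuclideanSpace.real_norm_sq_eq]
  simp [dotProduct, φ, sq]

/-- The weighted sum of the matrices `v i (v i)ᵀ` over `i ∈ S`. -/
noncomputable def weightedGram (v : Fin n → EuclideanSpace ℝ (Fin d)) (w : Fin n → ℝ)
    (S : Finset (Fin n)) : Matrix (Fin d) (Fin d) ℝ :=
  ∑ i ∈ S, w i • vecMulVec (v i).ofLp (v i).ofLp

theorem posSemidef_weightedGram (v : Fin n → EuclideanSpace ℝ (Fin d)) {w : Fin n → ℝ}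
    (hw : ∀ i, 0 ≤ w i) (S : Finset (Fin n)) : (weightedGram v w S).PosSemidef :=
  posSemidef_sum _ fun i _ => (posSemidef_vecMulVec_self_star (v i).ofLp).smul (hw i)

theorem weightedGram_insert (v : Fin n → EuclideanSpace ℝ (Fin d)) (w : Fin n → ℝ)
    {S : Finset (Fin n)} {x : Fin n} (hx : x ∉ S) : weightedGram v w (insert x S) =
      weightedGram v w S + w x • vecMulVec (v x).ofLp (v x).ofLp := by
  rw [weightedGram, Finset.sum_insert hx, add_comm]
  rfl

theorem det_add_weightedGram_mono (v : Fin n → EuclideanSpace ℝ (Fin d)) {w w' : Fin n → ℝ}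
    (hw : ∀ i, 0 ≤ w i) (hww' : ∀ i, w i ≤ w' i) (S : Finset (Fin n)) :
    ∀ {A : Matrix (Fin d) (Fin d) ℝ}, A.PosSemidef →
      (A + weightedGram v w S).det ≤ (A + weightedGram v w' S).det := by
  induction S using Finset.induction_on with
  | empty => intro A _; simp [weightedGram]
  | insert x S hx ih =>
    intro A hA
    rw [weightedGram_insert v w hx, weightedGram_insert v w' hx]
    have h1 := ih (hA.add ((posSemidef_vecMulVec_self_star (v x).ofLp).smul (hw x)))
    obtain ⟨N, hN⟩ := exists_seminorm_det_add_smul_vecMulVec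
      (hA.add (posSemidef_weightedGram v (fun i => (hw i).trans (hww' i)) S))
    have h2 := hN (v x) (w x)
    have h3 := hN (v x) (w' x)
    have h4 := mul_le_mul_of_nonneg_right (hww' x) (sq_nonneg (N (v x)))
    rw [star_trivial] at h1
    calc _ = (A + w x • vecMulVec (v x).ofLp (v x).ofLp + weightedGram v w S).det := by
          congr 1; abel
      _ ≤ _ := h1
      _ = (A + weightedGram v w' S + w x • vecMulVec (v x).ofLp (v x).ofLp).det := by
          congr 1; abel
      _ ≤ (A + weightedGram v w' S + w' x • vecMulVec (v x).ofLp (v x).ofLp).det := by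
          rw [h2, h3]; linarith
      _ = _ := by rw [add_assoc]

theorem detObjective_eq_gram {v : Fin n → EuclideanSpace ℝ (Fin d)} {S : Finset (Fin n)}
    (hS : S.card ≤ d) : detObjective v S = (gram ℝ fun i : S => v i).det := if_pos hS

theorem detObjective_eq_weightedGram {v : Fin n → EuclideanSpace ℝ (Fin d)} {S : Finset (Fin n)}
    (hS : d ≤ S.card) : detObjective v S = (weightedGram v 1 S).det := by
  rcases hS.eq_or_lt with h | h
  · rw [detObjective_eq_gram h.ge]
    let f : Fin d ≃ S := (S.equivFinOfCardEq h.symm).symm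
    let W : Matrix (Fin d) (Fin d) ℝ := of fun i a => v (f i) a
    have h1 : (gram ℝ fun i : S => v i).submatrix f f = W * Wᵀ := by
      ext i j
      simp [W, mul_apply, PiLp.inner_apply, mul_comm]
    have h2 : weightedGram v 1 S = Wᵀ * W := by
      ext a b
      simp only [weightedGram, Matrix.sum_apply, Pi.one_apply, one_smul, vecMulVec_apply, W,
        mul_apply, transpose_apply, of_apply]
      rw [← Finset.sum_coe_sort S, ← f.sum_comp]
    rw [← det_submatrix_equiv_self f, h1, h2, det_mul_comm]
  · rw [detObjective, if_neg (by omega)]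
    simp [weightedGram]
end Weighted

/-! ### From exchanges to composable coresets -/

section Exchange

variable {d n k : ℕ}

/-- `C ⊆ V` allows exchanges in `V`: every element `e ∈ V \ C` of a base `S` can be exchanged for
an element `u ∈ C` outside `S \ {e}`, giving again a base, such that the seminorm `N` of `v e` is
at most `κ` times that of `v u`. Here `N` is any member of a class `𝒢` that may depend on
`S \ {e}`. -/
def IsExchangeSet (M : Matroid (Fin n))
    (𝒢 : Finset (Fin n) → Set (Seminorm ℝ (EuclideanSpace ℝ (Fin d)))) (κ : ℝ)
    (v : Fin n → EuclideanSpace ℝ (Fin d)) (V C : Finset (Fin n)) : Prop :=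
  C ⊆ V ∧ ∀ S : Finset (Fin n), M.IsBase (S : Set (Fin n)) → ∀ e ∈ S, e ∈ V → e ∉ C →
    ∀ N ∈ 𝒢 (S.erase e), ∃ u ∈ C, u ∉ S.erase e ∧
      M.IsBase (insert u (S.erase e) : Finset (Fin n)) ∧ N (v e) ≤ κ * N (v u)

/-- The distance to the span of the vectors of `I`, the only seminorm relevant to the squared
volume of the sets `insert x I`. -/
def spanDistances (v : Fin n → EuclideanSpace ℝ (Fin d)) (I : Finset (Fin n)) :
    Set (Seminorm ℝ (EuclideanSpace ℝ (Fin d))) :=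
  {distSeminorm (span ℝ (v '' I))}

theorem Matroid.IsBase.card_eq_of_eRank_eq {M : Matroid (Fin n)} (hM : M.eRank = k)
    {S : Finset (Fin n)} (hS : M.IsBase (S : Set (Fin n))) : S.card = k := by
  have := hS.encard_eq_eRank
  rw [hM, Set.encard_coe_eq_coe_finsetCard] at this
  exact_mod_cast this

/-- Exchanging the elements of a base outside `C` one at a time leads to a base inside `C`. -/
theorem exists_isBase_subset_of_exchange {M : Matroid (Fin n)} (F : Finset (Fin n) → ℝ)
    {β : ℝ} (hβ : 0 ≤ β) {C W : Finset (Fin n)} (hCW : C ⊆ W)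
    (h : ∀ S : Finset (Fin n), M.IsBase (S : Set (Fin n)) → S ⊆ W → ∀ e ∈ S, e ∉ C →
      ∃ u ∈ C, M.IsBase (insert u (S.erase e) : Finset (Fin n)) ∧
        F S ≤ β * F (insert u (S.erase e))) :
    ∀ (r : ℕ) (S : Finset (Fin n)), M.IsBase (S : Set (Fin n)) → S ⊆ W →
      (S \ C).card = r →
      ∃ T : Finset (Fin n), M.IsBase (T : Set (Fin n)) ∧ T ⊆ C ∧ F S ≤ β ^ r * F T := by
  intro r
  induction r with
  | zero =>
    intro S hS hSW hr
    exact ⟨S, hS, Finset.sdiff_eq_empty_iff_subset.1 (Finset.card_eq_zero.1 hr), by simp⟩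
  | succ r ih =>
    intro S hS hSW hr
    obtain ⟨e, he⟩ := Finset.card_pos.1 (by omega : 0 < (S \ C).card)
    obtain ⟨heS, heC⟩ := Finset.mem_sdiff.1 he
    obtain ⟨u, huC, hbase, hF⟩ := h S hS hSW e heS heC
    have h1 : insert u (S.erase e) \ C = (S \ C).erase e := by
      rw [Finset.insert_sdiff_of_mem _ huC]
      ext x
      simp only [Finset.mem_sdiff, Finset.mem_erase]
      tauto
    obtain ⟨T, hT, hTC, hFT⟩ := ih _ hbase
      (Finset.insert_subset (hCW huC) ((Finset.erase_subset _ _).trans hSW))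
      (by rw [h1, Finset.card_erase_of_mem he, hr]; rfl)
    refine ⟨T, hT, hTC, hF.trans ?_⟩
    rw [pow_succ', mul_assoc]
    exact mul_le_mul_of_nonneg_left hFT hβ

/-- Below dimension `d`, each of the at most `k` exchanges multiplies the squared volume by the
square of a ratio of distances to the span of `S \ {e}`, hence loses at most `k ^ 2`. -/
theorem isComposableCoreset_of_le {M : Matroid (Fin n)} (hM : M.eRank = k) (hkd : k ≤ d)
    {v : Fin n → EuclideanSpace ℝ (Fin d)} {c : Finset (Fin n) → Finset (Fin n)}
    (hc : ∀ V, IsExchangeSet M (spanDistances v) k v V (c V)) :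
    IsComposableCoreset M (detObjective v) ((k : ℝ) ^ (2 * k)) c := by
  refine ⟨fun V => (hc V).1, fun m V S hS hSV => ?_⟩
  set C := Finset.univ.biUnion fun j => c (V j)
  have hobj : ∀ T : Finset (Fin n), M.IsBase (T : Set (Fin n)) →
      detObjective v T = (gram ℝ fun i : T => v i).det := fun T hT =>
    detObjective_eq_gram ((hT.card_eq_of_eRank_eq hM).trans_le hkd)
  have hCW : C ⊆ Finset.univ.biUnion V := Finset.biUnion_mono fun j _ => (hc (V j)).1
  obtain ⟨T, hT, hTC, hST⟩ := exists_isBase_subset_of_exchange (M := M) (detObjective v)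
    (β := (k : ℝ) ^ 2) (by positivity) hCW (fun S hS hSW e heS heC => by
      obtain ⟨j, -, hej⟩ := Finset.mem_biUnion.1 (hSW heS)
      obtain ⟨u, huC, huI, hbase, hN⟩ := (hc (V j)).2 S hS e heS hej
        (fun h => heC (Finset.mem_biUnion.2 ⟨j, Finset.mem_univ j, h⟩)) _ rfl
      refine ⟨u, Finset.mem_biUnion.2 ⟨j, Finset.mem_univ j, huC⟩, hbase, ?_⟩
      have h1 := det_gram_insert v (Finset.notMem_erase e S)
      rw [Finset.insert_erase heS] at h1
      rw [hobj S hS, hobj _ hbase, h1, det_gram_insert v huI, ← mul_assoc, ← mul_pow]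
      exact mul_le_mul_of_nonneg_right (pow_le_pow_left₀ (apply_nonneg _ _) hN 2)
        (posSemidef_gram ℝ _).det_nonneg) _ S hS hSV rfl
  refine ⟨T, hT, hTC, hST.trans ?_⟩
  refine mul_le_mul_of_nonneg_right ?_ (hobj T hT ▸ (posSemidef_gram ℝ _).det_nonneg)
  have hr : (S \ C).card ≤ k :=
    (Finset.card_le_card Finset.sdiff_subset).trans (hS.card_eq_of_eRank_eq hM).le
  rw [← pow_mul]
  rcases Nat.eq_zero_or_pos k with rfl | hk
  · rw [Nat.le_zero.1 hr]
  · exact pow_le_pow_right₀ (by exact_mod_cast hk) (by omega)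

/-- The potential is the determinant in which the elements that already lie in the coreset carry
weight `d ^ 2`. It does not decrease under the exchanges, so the factor `d ^ 2` is lost only once
for each of the `d` dimensions, however many elements are exchanged. -/
theorem isComposableCoreset_of_ge {M : Matroid (Fin n)} (hM : M.eRank = k) (hd : 1 ≤ d)
    (hdk : d ≤ k) {v : Fin n → EuclideanSpace ℝ (Fin d)} {c : Finset (Fin n) → Finset (Fin n)}
    (hc : ∀ V, IsExchangeSet M (fun _ => Set.univ) d v V (c V)) :
    IsComposableCoreset M (detObjective v) ((d : ℝ) ^ (2 * d)) c := by
  refine ⟨fun V => (hc V).1, fun m V S hS hSV => ?_⟩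
  set C := Finset.univ.biUnion fun j => c (V j)
  have hobj : ∀ T : Finset (Fin n), M.IsBase (T : Set (Fin n)) →
      detObjective v T = (weightedGram v 1 T).det := fun T hT =>
    detObjective_eq_weightedGram (hdk.trans_eq (hT.card_eq_of_eRank_eq hM).symm)
  have hCW : C ⊆ Finset.univ.biUnion V := Finset.biUnion_mono fun j _ => (hc (V j)).1
  let w : Fin n → ℝ := fun i => if i ∈ C then (d : ℝ) ^ 2 else 1
  have hd1 : (1 : ℝ) ≤ (d : ℝ) ^ 2 := one_le_pow₀ (by exact_mod_cast hd)
  have hw1 : ∀ i, (1 : Fin n → ℝ) i ≤ w i := fun i => by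
    simp only [w, Pi.one_apply]; split_ifs <;> linarith
  have hw0 : ∀ i, 0 ≤ w i := fun i => zero_le_one.trans (hw1 i)
  obtain ⟨T, hT, hTC, hST⟩ := exists_isBase_subset_of_exchange (M := M)
    (fun S => (weightedGram v w S).det) zero_le_one hCW (fun S hS hSW e heS heC => by
      obtain ⟨j, -, hej⟩ := Finset.mem_biUnion.1 (hSW heS)
      obtain ⟨N, hN⟩ := exists_seminorm_det_add_smul_vecMulVec
        (posSemidef_weightedGram v hw0 (S.erase e))
      obtain ⟨u, huC, huI, hbase, hNu⟩ := (hc (V j)).2 S hS e heS hej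
        (fun h => heC (Finset.mem_biUnion.2 ⟨j, Finset.mem_univ j, h⟩)) N (Set.mem_univ N)
      have huC' : u ∈ C := Finset.mem_biUnion.2 ⟨j, Finset.mem_univ j, huC⟩
      refine ⟨u, huC', hbase, ?_⟩
      have h1 := weightedGram_insert v w (Finset.notMem_erase e S)
      rw [Finset.insert_erase heS] at h1
      rw [h1, weightedGram_insert v w huI, hN, hN, one_mul]
      simp only [w, if_pos huC', if_neg heC, one_mul, ← mul_pow]
      gcongr) _ S hS hSV rfl
  rw [one_pow, one_mul] at hST
  refine ⟨T, hT, hTC, ?_⟩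
  have h1 := det_add_weightedGram_mono v (fun _ => zero_le_one) hw1 S PosSemidef.zero
  have h2 : weightedGram v w T = (d : ℝ) ^ 2 • weightedGram v 1 T := by
    rw [weightedGram, weightedGram, Finset.smul_sum]
    refine Finset.sum_congr rfl fun i hi => ?_
    simp only [w, if_pos (hTC hi), Pi.one_apply, one_smul]
  rw [zero_add, zero_add] at h1
  rw [hobj S hS, hobj T hT]
  rw [h2, det_smul, Fintype.card_fin, ← pow_mul] at hST
  exact h1.trans hST

/-- A construction `D` of exchange sets from a choice `sp` of spanners yields a composable coreset.
As spanners are chosen after replacing the vectors outside `V` by zero, the coreset of `V` is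
computed from the vectors indexed by `V` only. -/
theorem hasComposableCoreset_of_spanners {M : Matroid (Fin n)} {α κ : ℝ} {b b₀ : ℕ}
    {𝒮 : Set (Seminorm ℝ (EuclideanSpace ℝ (Fin d)))}
    {𝒢 : (Fin n → EuclideanSpace ℝ (Fin d)) → Finset (Fin n) →
      Set (Seminorm ℝ (EuclideanSpace ℝ (Fin d)))}
    (hsp : ∀ (v : Fin n → EuclideanSpace ℝ (Fin d)) (X : Finset (Fin n)),
      ∃ Y, Y.card ≤ b₀ ∧ IsSpanner 𝒮 κ v X Y)
    (D : (Finset (Fin n) → Finset (Fin n)) → Finset (Fin n) → Finset (Fin n))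
    (hDcard : ∀ sp V, (∀ X, (sp X).card ≤ b₀) → (D sp V).card ≤ b)
    (hD : ∀ v sp V, (∀ X ⊆ V, IsSpanner 𝒮 κ v X (sp X)) → IsExchangeSet M (𝒢 v) κ v V (D sp V))
    (hcomp : ∀ v c, (∀ V, IsExchangeSet M (𝒢 v) κ v V (c V)) →
      IsComposableCoreset M (detObjective v) α c) :
    HasComposableCoreset M d α b := by
  choose sp hspcard hspan using hsp
  let mask : (Fin n → EuclideanSpace ℝ (Fin d)) → Finset (Fin n) →
    Fin n → EuclideanSpace ℝ (Fin d) := fun v V i => if i ∈ V then v i else 0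
  refine ⟨fun v V => D (sp (mask v V)) V, fun v w V h => ?_, fun v => ⟨hcomp v _ fun V => ?_,
    fun V => hDcard _ _ (hspcard _)⟩⟩
  · have : mask v V = mask w V := by
      ext1 i
      by_cases hi : i ∈ V
      · simp only [mask, if_pos hi, h i hi]
      · simp only [mask, if_neg hi]
    simp only [this]
  · refine hD v _ V fun X hX => ⟨(hspan (mask v V) X).1, fun N hN e he => ?_⟩
    obtain ⟨u, hu, hNu⟩ := (hspan (mask v V) X).2 N hN e he
    have huX := (hspan (mask v V) X).1 hu
    simp only [mask, if_pos (hX he), if_pos (hX huX)] at hNu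
    exact ⟨u, hu, hNu⟩

/-- A matroid of rank zero has only the empty base. -/
theorem hasComposableCoreset_of_eRank_eq_zero {M : Matroid (Fin n)} (hM : M.eRank = (0 : ℕ))
    {α : ℝ} (hα : α = 1) (b : ℕ) : HasComposableCoreset M d α b := by
  subst hα
  refine ⟨fun _ _ => ∅, fun _ _ _ _ => rfl, fun v => ⟨⟨fun _ => Finset.empty_subset _, ?_⟩,
    fun _ => Nat.zero_le _⟩⟩
  intro m V S hS _
  have hS0 : S = ∅ := Finset.card_eq_zero.1 (hS.card_eq_of_eRank_eq hM)
  subst hS0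
  exact ⟨∅, hS, Finset.empty_subset _, (one_mul _).ge⟩

theorem spanDistances_subset {v : Fin n → EuclideanSpace ℝ (Fin d)} {I : Finset (Fin n)}
    (hI : I.card < k) : spanDistances v I ⊆
      {N | ∃ H : Submodule ℝ (EuclideanSpace ℝ (Fin d)), finrank ℝ H < k ∧ N = distSeminorm H} := by
  rintro _ rfl
  refine ⟨_, ?_, rfl⟩
  rw [← Finset.coe_image]
  exact (finrank_span_finset_le_card _).trans_lt (Finset.card_image_le.trans_lt hI)
end Exchange

/-! ### Exchanges in laminar matroids -/

section LaminarBases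

variable {d n t k : ℕ} {F : Fin t → Finset (Fin n)} {hF : IsLaminarFamily F} {cap : Fin t → ℕ}

theorem laminarMatroid_isBase_iff (hM : (laminarMatroid F hF cap).eRank = k)
    {S : Finset (Fin n)} :
    (laminarMatroid F hF cap).IsBase (S : Set (Fin n)) ↔ CapIndep F cap S ∧ S.card = k := by
  refine ⟨fun h => ⟨(laminarMatroid_indep_iff F hF cap S).1 h.indep, h.card_eq_of_eRank_eq hM⟩,
    fun ⟨h, hk⟩ => ?_⟩
  have hi : (laminarMatroid F hF cap).Indep (S : Set (Fin n)) :=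
    (laminarMatroid_indep_iff F hF cap S).2 h
  refine hi.isBase_of_eRk_ge S.finite_toSet ?_
  rw [hi.eRk_eq_encard, hM, Set.encard_coe_eq_coe_finsetCard, hk]

/-- An element `u` can replace `e` in a base unless it lies in a tight set that does not contain
`e`. -/
theorem laminarMatroid_isBase_exchange (hM : (laminarMatroid F hF cap).eRank = k)
    {S : Finset (Fin n)} (hS : (laminarMatroid F hF cap).IsBase (S : Set (Fin n))) {e u : Fin n}
    (he : e ∈ S) (hu : u ∉ S.erase e)
    (h : ∀ i, u ∈ F i → e ∉ F i → (S ∩ F i).card < cap i) :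
    (laminarMatroid F hF cap).IsBase (insert u (S.erase e) : Finset (Fin n)) := by
  obtain ⟨hcap, hcard⟩ := (laminarMatroid_isBase_iff hM).1 hS
  refine (laminarMatroid_isBase_iff hM).2 ⟨fun i => ?_, ?_⟩
  · by_cases hui : u ∈ F i
    · by_cases hei : e ∈ F i
      · have h1 : insert u (S.erase e) ∩ F i ⊆ insert u ((S ∩ F i).erase e) := by
          intro x
          simp only [Finset.mem_inter, Finset.mem_insert, Finset.mem_erase]
          tauto
        have h2 := (Finset.card_le_card h1).trans (Finset.card_insert_le _ _)
        rw [Finset.card_erase_add_one (Finset.mem_inter.2 ⟨he, hei⟩)] at h2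
        exact h2.trans (hcap i)
      · have h1 : insert u (S.erase e) ∩ F i ⊆ insert u (S ∩ F i) := by
          intro x
          simp only [Finset.mem_inter, Finset.mem_insert, Finset.mem_erase]
          tauto
        exact ((Finset.card_le_card h1).trans (Finset.card_insert_le _ _)).trans (h i hui hei)
    · have h1 : insert u (S.erase e) ∩ F i ⊆ S ∩ F i := by
        intro x
        simp only [Finset.mem_inter, Finset.mem_insert, Finset.mem_erase]
        rintro ⟨rfl | hx, hxi⟩
        · exact absurd hxi hui
        · exact ⟨hx.2, hxi⟩
      exact (Finset.card_le_card h1).trans (hcap i)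
  · rw [Finset.card_insert_of_notMem hu, Finset.card_erase_add_one he, hcard]
end LaminarBases

/-! ### Partition matroids -/

section Partition

variable {d n s k : ℕ} {P : Fin s → Finset (Fin n)} {hP : IsIndexedPartition P} {cap : Fin s → ℕ}

theorem partitionMatroid_isBase_exchange (hM : (partitionMatroid P hP cap).eRank = k)
    {S : Finset (Fin n)} (hS : (partitionMatroid P hP cap).IsBase (S : Set (Fin n))) {e u : Fin n}
    (he : e ∈ S) (hu : u ∉ S.erase e) {i : Fin s} (hei : e ∈ P i) (hui : u ∈ P i) :
    (partitionMatroid P hP cap).IsBase (insert u (S.erase e) : Finset (Fin n)) :=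
  laminarMatroid_isBase_exchange hM hS he hu fun _ huj hej =>
    absurd ((hP u).unique hui huj ▸ hei) hej

/-- Within each part, a spanner suffices; it is padded to `k` elements so that an exchange exists
even if all the volumes vanish. -/
theorem partitionMatroid_hasComposableCoreset_of_le
    (hM : (partitionMatroid P hP cap).eRank = k) (hkd : k ≤ d) :
    HasComposableCoreset (partitionMatroid P hP cap) d ((k : ℝ) ^ (2 * k)) (2 * (s * k)) := by
  rcases Nat.eq_zero_or_pos k with rfl | hk
  · exact hasComposableCoreset_of_eRank_eq_zero hM (by simp) _
  choose pad hpad hpadcard using fun X : Finset (Fin n) =>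
    Finset.exists_subset_card_eq (min_le_right k X.card)
  refine hasComposableCoreset_of_spanners (fun v X => exists_isSpanner_dist v X hk)
    (fun sp V => Finset.univ.biUnion fun i => sp (V ∩ P i) ∪ pad (V ∩ P i)) ?_ ?_
    (fun v c => isComposableCoreset_of_le hM hkd)
  · intro sp V hsp
    refine (Finset.card_biUnion_le_card_mul _ _ (2 * k) fun i _ => ?_).trans
      (by rw [Finset.card_univ, Fintype.card_fin]; exact le_of_eq (by ring))
    have h1 := hsp (V ∩ P i)
    have h2 := hpadcard (V ∩ P i)
    have h3 := Finset.card_union_le (sp (V ∩ P i)) (pad (V ∩ P i))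
    have h4 := min_le_left k (V ∩ P i).card
    omega
  · intro v sp V hsp
    have hsub : ∀ i, sp (V ∩ P i) ∪ pad (V ∩ P i) ⊆ V ∩ P i := fun i =>
      Finset.union_subset (hsp _ Finset.inter_subset_left).1 (hpad _)
    refine ⟨Finset.biUnion_subset.2 fun i _ => (hsub i).trans Finset.inter_subset_left, ?_⟩
    intro S hS e heS heV heC N hN
    obtain ⟨i, hei, -⟩ := hP e
    have heX : e ∈ V ∩ P i := Finset.mem_inter.2 ⟨heV, hei⟩
    have hcard : (S.erase e).card < k := by
      rw [← hS.card_eq_of_eRank_eq hM]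
      exact Finset.card_erase_lt_of_mem heS
    suffices h : ∃ u ∈ sp (V ∩ P i) ∪ pad (V ∩ P i), u ∉ S.erase e ∧ N (v e) ≤ k * N (v u) by
      obtain ⟨u, hu, huI, hNu⟩ := h
      exact ⟨u, Finset.mem_biUnion.2 ⟨i, Finset.mem_univ i, hu⟩, huI,
        partitionMatroid_isBase_exchange hM hS heS huI hei (Finset.mem_inter.1 (hsub i hu)).2, hNu⟩
    obtain ⟨u, hu, hNu⟩ :=
      (hsp _ Finset.inter_subset_left).2 N (spanDistances_subset hcard hN) e heX
    by_cases huI : u ∈ S.erase e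
    · -- the seminorm vanishes at `v u`, hence at `v e`, so that any padding element will do
      have hNu0 : N (v u) = 0 := by
        rw [show N = _ from hN]
        exact distSeminorm_eq_zero_iff.2 (subset_span (Set.mem_image_of_mem v huI))
      have hpadk : k ≤ (pad (V ∩ P i)).card := by
        by_contra hlt
        have h1 := hpadcard (V ∩ P i)
        have h2 : pad (V ∩ P i) = V ∩ P i :=
          Finset.eq_of_subset_of_card_le (hpad _) (by omega)
        exact heC (Finset.mem_biUnion.2 ⟨i, Finset.mem_univ i,
          Finset.mem_union_right _ (h2.symm ▸ heX)⟩)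
      obtain ⟨x, hx, hxI⟩ := Finset.exists_mem_notMem_of_card_lt_card (hcard.trans_le hpadk)
      refine ⟨x, Finset.mem_union_right _ hx, hxI, ?_⟩
      rw [hNu0, mul_zero] at hNu
      exact hNu.trans (by positivity)
    · exact ⟨u, Finset.mem_union_left _ hu, huI, hNu⟩

/-- The union of `l` successive spanners, each for the elements of `X` not yet taken. -/
def spannerLayers (sp : Finset (Fin n) → Finset (Fin n)) (X : Finset (Fin n)) :
    ℕ → Finset (Fin n)
  | 0 => ∅
  | l + 1 => spannerLayers sp X l ∪ sp (X \ spannerLayers sp X l)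

theorem card_spannerLayers_le {sp : Finset (Fin n) → Finset (Fin n)} {b : ℕ}
    (hsp : ∀ X, (sp X).card ≤ b) (X : Finset (Fin n)) (l : ℕ) :
    (spannerLayers sp X l).card ≤ l * b := by
  induction l with
  | zero => simp [spannerLayers]
  | succ l ih =>
    rw [add_mul, one_mul]
    exact (Finset.card_union_le _ _).trans (add_le_add ih (hsp _))

theorem spannerLayers_subset {sp : Finset (Fin n) → Finset (Fin n)} {X : Finset (Fin n)}
    (hsp : ∀ Y ⊆ X, sp Y ⊆ Y) (l : ℕ) : spannerLayers sp X l ⊆ X := by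
  induction l with
  | zero => exact Finset.empty_subset _
  | succ l ih =>
    exact Finset.union_subset ih
      ((hsp _ Finset.sdiff_subset).trans Finset.sdiff_subset)

/-- An element left out by all layers is dominated by one element in each of them. -/
theorem exists_subset_spannerLayers {𝒮 : Set (Seminorm ℝ (EuclideanSpace ℝ (Fin d)))} {κ : ℝ}
    {v : Fin n → EuclideanSpace ℝ (Fin d)} {sp : Finset (Fin n) → Finset (Fin n)}
    {X : Finset (Fin n)} (hsp : ∀ Y ⊆ X, IsSpanner 𝒮 κ v Y (sp Y))
    {N : Seminorm ℝ (EuclideanSpace ℝ (Fin d))} (hN : N ∈ 𝒮) {e : Fin n} (he : e ∈ X) (l : ℕ)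
    (hel : e ∉ spannerLayers sp X l) :
    ∃ G ⊆ spannerLayers sp X l, G.card = l ∧ ∀ u ∈ G, N (v e) ≤ κ * N (v u) := by
  induction l with
  | zero => exact ⟨∅, subset_rfl, rfl, by simp⟩
  | succ l ih =>
    have hel' : e ∉ spannerLayers sp X l := fun h => hel (Finset.mem_union_left _ h)
    obtain ⟨G, hGsub, hGcard, hG⟩ := ih hel'
    obtain ⟨u, hu, hNu⟩ := (hsp (X \ spannerLayers sp X l) Finset.sdiff_subset).2 N hN e
      (Finset.mem_sdiff.2 ⟨he, hel'⟩)
    have huX := (hsp _ Finset.sdiff_subset).1 hu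
    have huG : u ∉ G := fun h => (Finset.mem_sdiff.1 huX).2 (hGsub h)
    refine ⟨insert u G, Finset.insert_subset (Finset.mem_union_right _ hu)
      (hGsub.trans Finset.subset_union_left), ?_, fun x hx => ?_⟩
    · rw [Finset.card_insert_of_notMem huG, hGcard]
    · rcases Finset.mem_insert.1 hx with rfl | hx
      · exact hNu
      · exact hG x hx

/-- Taking `min (cap i) |P i|` elements of each part gives an independent set. -/
theorem sum_min_cap_card_le (hM : (partitionMatroid P hP cap).eRank = k) :
    ∑ i, min (cap i) (P i).card ≤ k := by
  choose A hAP hAcard using fun i => Finset.exists_subset_card_eq (min_le_right (cap i) (P i).card)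
  have hdisj : ∀ i j, i ≠ j → Disjoint (A i) (A j) := fun i j hij =>
    Finset.disjoint_left.2 fun x hxi hxj => hij ((hP x).unique (hAP i hxi) (hAP j hxj))
  have hind : (partitionMatroid P hP cap).Indep (Finset.univ.biUnion A : Finset (Fin n)) := by
    refine (laminarMatroid_indep_iff P _ cap _).2 fun i => ?_
    have h1 : Finset.univ.biUnion A ∩ P i ⊆ A i := fun x hx => by
      obtain ⟨hx1, hxi⟩ := Finset.mem_inter.1 hx
      obtain ⟨j, -, hxj⟩ := Finset.mem_biUnion.1 hx1
      rwa [(hP x).unique hxi (hAP j hxj)]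
    exact (Finset.card_le_card h1).trans ((hAcard i).le.trans (min_le_left _ _))
  have h1 := hind.encard_le_eRank
  rw [hM, Set.encard_coe_eq_coe_finsetCard,
    Finset.card_biUnion fun i _ j _ hij => hdisj i j hij] at h1
  simp only [hAcard] at h1
  exact_mod_cast h1

/-- As many layers of spanners as a base may have elements in a part leave one layer's candidate
outside the base. -/
theorem partitionMatroid_hasComposableCoreset_of_ge
    (hM : (partitionMatroid P hP cap).eRank = k) (hd : 1 ≤ d) (hdk : d ≤ k) :
    HasComposableCoreset (partitionMatroid P hP cap) d ((d : ℝ) ^ (2 * d)) (k * d) := by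
  have hfin : finrank ℝ (EuclideanSpace ℝ (Fin d)) = d := finrank_euclideanSpace_fin
  refine hasComposableCoreset_of_spanners (b₀ := d) (κ := d) (𝒮 := Set.univ)
    (fun v X => by simpa only [hfin] using exists_isSpanner_univ v X (hd.trans_eq hfin.symm))
    (fun sp V => Finset.univ.biUnion fun i =>
      spannerLayers sp (V ∩ P i) (min (cap i) (P i).card)) ?_ ?_
    (fun v c => isComposableCoreset_of_ge hM hd hdk)
  · intro sp V hsp
    refine Finset.card_biUnion_le.trans ((Finset.sum_le_sum fun i _ =>
      card_spannerLayers_le hsp _ _).trans ?_)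
    rw [← Finset.sum_mul]
    exact Nat.mul_le_mul_right d (sum_min_cap_card_le hM)
  · intro v sp V hsp
    have hsp' : ∀ i, ∀ Y ⊆ V ∩ P i, IsSpanner Set.univ d v Y (sp Y) := fun i Y hY =>
      hsp Y (hY.trans Finset.inter_subset_left)
    have hsub : ∀ i l, spannerLayers sp (V ∩ P i) l ⊆ V ∩ P i := fun i l =>
      spannerLayers_subset (fun Y hY => (hsp' i Y hY).1) l
    refine ⟨Finset.biUnion_subset.2 fun i _ => (hsub i _).trans Finset.inter_subset_left, ?_⟩
    intro S hS e heS heV heC N hN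
    obtain ⟨i, hei, -⟩ := hP e
    obtain ⟨G, hGsub, hGcard, hG⟩ := exists_subset_spannerLayers (hsp' i) hN
      (Finset.mem_inter.2 ⟨heV, hei⟩) (min (cap i) (P i).card)
      (fun h => heC (Finset.mem_biUnion.2 ⟨i, Finset.mem_univ i, h⟩))
    have hcard : (S.erase e ∩ P i).card < G.card := by
      have h1 : (S.erase e ∩ P i).card < (S ∩ P i).card := by
        rw [Finset.erase_inter]
        exact Finset.card_erase_lt_of_mem (Finset.mem_inter.2 ⟨heS, hei⟩)
      have h2 := (laminarMatroid_indep_iff P _ cap S).1 hS.indep i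
      have h3 : (S ∩ P i).card ≤ (P i).card := Finset.card_le_card Finset.inter_subset_right
      omega
    obtain ⟨u, huG, hu⟩ := Finset.exists_mem_notMem_of_card_lt_card hcard
    have hui := (Finset.mem_inter.1 (hsub i _ (hGsub huG))).2
    have huI : u ∉ S.erase e := fun h => hu (Finset.mem_inter.2 ⟨h, hui⟩)
    exact ⟨u, Finset.mem_biUnion.2 ⟨i, Finset.mem_univ i, hGsub huG⟩, huI,
      partitionMatroid_isBase_exchange hM hS heS huI hei hui, hG u huG⟩
end Partition

/-! ### Laminar matroids -/

section Laminar

variable {d n t k : ℕ} {F : Fin t → Finset (Fin n)} {cap : Fin t → ℕ}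

/-- The union of the members of capacity `c` that contain `u`, or `{u}` if there are none. -/
def capBlock (F : Fin t → Finset (Fin n)) (cap : Fin t → ℕ) (u : Fin n) (c : ℕ) :
    Finset (Fin n) :=
  insert u ((Finset.univ.filter fun i => u ∈ F i ∧ cap i = c).biUnion F)

/-- Spanners of `X` and of the sets obtained from it by removing at most `l` blocks, each of them a
block of an element of the preceding spanner. -/
def spannerTree (F : Fin t → Finset (Fin n)) (cap : Fin t → ℕ) (k : ℕ)
    (sp : Finset (Fin n) → Finset (Fin n)) : ℕ → Finset (Fin n) → Finset (Fin n)
  | 0, X => sp X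
  | l + 1, X => sp X ∪ (sp X).biUnion fun u => (Finset.Icc 1 (k - 1)).biUnion fun c =>
      spannerTree F cap k sp l (X \ capBlock F cap u c)

theorem spannerTree_subset {sp : Finset (Fin n) → Finset (Fin n)} {V : Finset (Fin n)}
    (hsp : ∀ X ⊆ V, sp X ⊆ X) (l : ℕ) : ∀ X ⊆ V, spannerTree F cap k sp l X ⊆ X := by
  induction l with
  | zero => exact hsp
  | succ l ih =>
    intro X hX
    refine Finset.union_subset (hsp X hX) (Finset.biUnion_subset.2 fun u _ =>
      Finset.biUnion_subset.2 fun c _ => ?_)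
    exact (ih _ (Finset.sdiff_subset.trans hX)).trans Finset.sdiff_subset

theorem subset_spannerTree {sp : Finset (Fin n) → Finset (Fin n)} (l : ℕ) (X : Finset (Fin n)) :
    sp X ⊆ spannerTree F cap k sp l X := by
  cases l with
  | zero => exact subset_rfl
  | succ l => exact Finset.subset_union_left

theorem card_spannerTree_le {sp : Finset (Fin n) → Finset (Fin n)} {b : ℕ} (hb : 1 ≤ b)
    (hk : 1 ≤ k) (hsp : ∀ X, (sp X).card ≤ b) (l : ℕ) :
    ∀ X, (spannerTree F cap k sp l X).card ≤ (b * k) ^ (l + 1) := by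
  induction l with
  | zero =>
    intro X
    rw [zero_add, pow_one]
    exact (hsp X).trans (Nat.le_mul_of_pos_right b hk)
  | succ l ih =>
    intro X
    have h1 : ((sp X).biUnion fun u => (Finset.Icc 1 (k - 1)).biUnion fun c =>
        spannerTree F cap k sp l (X \ capBlock F cap u c)).card ≤
        b * ((k - 1) * (b * k) ^ (l + 1)) := by
      refine (Finset.card_biUnion_le_card_mul _ _ _ fun u _ => ?_).trans
        (Nat.mul_le_mul_right _ (hsp X))
      refine (Finset.card_biUnion_le_card_mul _ _ _ fun c _ => ih _).trans ?_
      rw [Nat.card_Icc, Nat.add_sub_cancel]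
    have h2 : b ≤ b * (b * k) ^ (l + 1) :=
      Nat.le_mul_of_pos_right b (Nat.pow_pos (Nat.mul_pos hb hk))
    calc _ ≤ b + b * ((k - 1) * (b * k) ^ (l + 1)) :=
          (Finset.card_union_le _ _).trans (add_le_add (hsp X) h1)
      _ ≤ b * (b * k) ^ (l + 1) + b * ((k - 1) * (b * k) ^ (l + 1)) := Nat.add_le_add_right h2 _
      _ = b * (((k - 1) + 1) * (b * k) ^ (l + 1)) := by ring
      _ = (b * k) ^ (l + 1 + 1) := by rw [Nat.sub_add_cancel hk]; ring

/-- For a base `S` and `e ∈ S`, the elements of `S \ {e}` and those that cannot be added to it: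
they lie in a tight member not containing `e`. -/
def IsBlocked (F : Fin t → Finset (Fin n)) (cap : Fin t → ℕ) (S : Finset (Fin n)) (e u : Fin n) :
    Prop :=
  u ∈ S.erase e ∨ ∃ i, u ∈ F i ∧ e ∉ F i ∧ cap i ≤ (S ∩ F i).card

/-- The union of the tight members that contain `u` but not `e`, or `{u}` if there are none. -/
def tightBlock (F : Fin t → Finset (Fin n)) (cap : Fin t → ℕ) (S : Finset (Fin n)) (e u : Fin n) :
    Finset (Fin n) :=
  insert u ((Finset.univ.filter fun i => u ∈ F i ∧ e ∉ F i ∧ cap i ≤ (S ∩ F i).card).biUnion F)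

theorem self_mem_tightBlock (S : Finset (Fin n)) (e u : Fin n) : u ∈ tightBlock F cap S e u :=
  Finset.mem_insert_self _ _

theorem subset_tightBlock {S : Finset (Fin n)} {e u : Fin n} {i : Fin t} (hui : u ∈ F i)
    (hei : e ∉ F i) (hi : cap i ≤ (S ∩ F i).card) : F i ⊆ tightBlock F cap S e u :=
  (Finset.subset_biUnion_of_mem F (Finset.mem_filter.2 ⟨Finset.mem_univ i, hui, hei, hi⟩)).trans
    (Finset.subset_insert _ _)

/-- The tight members containing `u` but not `e` form a chain, hence their union is one of them. -/
theorem tightBlock_eq (hF : IsLaminarFamily F) (S : Finset (Fin n)) (e u : Fin n) :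
    ((∀ i, u ∈ F i → e ∉ F i → (S ∩ F i).card < cap i) ∧ tightBlock F cap S e u = {u}) ∨
      ∃ m, u ∈ F m ∧ e ∉ F m ∧ cap m ≤ (S ∩ F m).card ∧ tightBlock F cap S e u = F m := by
  let I := Finset.univ.filter fun i => u ∈ F i ∧ e ∉ F i ∧ cap i ≤ (S ∩ F i).card
  rcases I.eq_empty_or_nonempty with h | h
  · refine Or.inl ⟨fun i hui hei => ?_, ?_⟩
    · by_contra! hi
      have : i ∈ I := Finset.mem_filter.2 ⟨Finset.mem_univ i, hui, hei, hi⟩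
      rw [h] at this
      exact Finset.notMem_empty i this
    · change insert u (I.biUnion F) = {u}
      rw [h]
      rfl
  · obtain ⟨m, hm, hmax⟩ := I.exists_max_image (fun i => (F i).card) h
    obtain ⟨-, hum, hem, hcm⟩ := Finset.mem_filter.1 hm
    refine Or.inr ⟨m, hum, hem, hcm, Finset.Subset.antisymm ?_ (subset_tightBlock hum hem hcm)⟩
    refine Finset.insert_subset hum (Finset.biUnion_subset.2 fun i hi => ?_)
    obtain ⟨-, hui, -, -⟩ := Finset.mem_filter.1 hi
    rcases hF i m with h1 | h1 | h1
    · exact absurd hum (Finset.disjoint_left.1 h1 hui)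
    · exact h1
    · exact (Finset.eq_of_subset_of_card_le h1 (hmax i hi)).ge

theorem disjoint_tightBlock (hF : IsLaminarFamily F) {S : Finset (Fin n)} {e u u' : Fin n}
    (h : u' ∉ tightBlock F cap S e u) :
    Disjoint (tightBlock F cap S e u') (tightBlock F cap S e u) := by
  rcases tightBlock_eq (cap := cap) hF S e u' with ⟨-, hu'⟩ | ⟨m', hum', hem', hcm', hu'⟩
  · rw [hu']
    exact Finset.disjoint_singleton_left.2 h
  · rcases tightBlock_eq (cap := cap) hF S e u with ⟨hno, hu⟩ | ⟨m, hum, hem, hcm, hu⟩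
    · rw [hu, hu']
      exact Finset.disjoint_singleton_right.2 fun hmem => (hno m' hmem hem').not_ge hcm'
    · rw [hu] at h
      rw [hu', hu]
      rcases hF m' m with h1 | h1 | h1
      · exact h1
      · exact absurd (h1 hum') h
      · have h2 := subset_tightBlock (h1 hum) hem' hcm'
        rw [hu] at h2
        exact absurd (h2 hum') h

theorem notMem_tightBlock {S : Finset (Fin n)} {e u : Fin n} (h : IsBlocked F cap S e u) :
    e ∉ tightBlock F cap S e u := by
  intro he
  rcases Finset.mem_insert.1 he with rfl | he
  · rcases h with h | ⟨i, h1, h2, -⟩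
    · exact Finset.notMem_erase _ _ h
    · exact h2 h1
  · obtain ⟨i, hi, hei⟩ := Finset.mem_biUnion.1 he
    exact (Finset.mem_filter.1 hi).2.2.1 hei

theorem exists_mem_erase_mem_tightBlock (hF : IsLaminarFamily F) {S : Finset (Fin n)} {e u : Fin n}
    (h : IsBlocked F cap S e u) (hu : ∀ i, u ∈ F i → 1 ≤ cap i) :
    ∃ x ∈ S.erase e, x ∈ tightBlock F cap S e u := by
  rcases tightBlock_eq (cap := cap) hF S e u with ⟨hno, -⟩ | ⟨m, hum, hem, hcm, heq⟩
  · rcases h with h | ⟨i, h1, h2, h3⟩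
    · exact ⟨u, h, self_mem_tightBlock S e u⟩
    · exact absurd h3 (hno i h1 h2).not_ge
  · obtain ⟨x, hx⟩ := Finset.card_pos.1 ((hu m hum).trans hcm)
    obtain ⟨hxS, hxm⟩ := Finset.mem_inter.1 hx
    exact ⟨x, Finset.mem_erase.2 ⟨fun hxe => hem (hxe ▸ hxm), hxS⟩, heq ▸ hxm⟩

/-- The block of tight members around a blocked element is determined by a single capacity, which
is less than the rank. -/
theorem exists_capBlock_eq_tightBlock (hF : IsLaminarFamily F) {S : Finset (Fin n)}
    (hS : CapIndep F cap S) (hSk : S.card = k) {e u : Fin n} (he : e ∈ S)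
    (h : IsBlocked F cap S e u) (hu : ∀ i, u ∈ F i → 1 ≤ cap i) :
    ∃ c ∈ Finset.Icc 1 (k - 1), capBlock F cap u c = tightBlock F cap S e u := by
  have hsub : ∀ i, e ∉ F i → S ∩ F i ⊆ S.erase e := fun i hei x hx => by
    obtain ⟨hxS, hxi⟩ := Finset.mem_inter.1 hx
    exact Finset.mem_erase.2 ⟨fun hxe => hei (hxe ▸ hxi), hxS⟩
  have hcard : (S.erase e).card = k - 1 := by rw [Finset.card_erase_of_mem he, hSk]
  rcases tightBlock_eq (cap := cap) hF S e u with ⟨hno, heq⟩ | ⟨m, hum, hem, hcm, heq⟩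
  · rcases h with huI | ⟨i, h1, h2, h3⟩
    · obtain ⟨hue, huS⟩ := Finset.mem_erase.1 huI
      refine ⟨1, Finset.mem_Icc.2 ⟨le_rfl, ?_⟩, ?_⟩
      · rw [← hcard]
        exact Finset.card_pos.2 ⟨u, huI⟩
      · -- a member of capacity one containing `u ∈ S` is tight, and cannot contain `e`
        have hempty : (Finset.univ.filter fun i => u ∈ F i ∧ cap i = 1) = ∅ := by
          refine Finset.filter_eq_empty_iff.2 fun i _ ⟨hui, hci⟩ => ?_
          have h1 := hS i
          by_cases hei : e ∈ F i
          · have h2 : 1 < (S ∩ F i).card := Finset.one_lt_card.2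
              ⟨u, Finset.mem_inter.2 ⟨huS, hui⟩, e, Finset.mem_inter.2 ⟨he, hei⟩, hue⟩
            omega
          · have h2 : 0 < (S ∩ F i).card := Finset.card_pos.2 ⟨u, Finset.mem_inter.2 ⟨huS, hui⟩⟩
            have h3 := hno i hui hei
            omega
        rw [capBlock, hempty, heq]
        rfl
    · exact absurd h3 (hno i h1 h2).not_ge
  · refine ⟨cap m, Finset.mem_Icc.2 ⟨hu m hum, ?_⟩, ?_⟩
    · rw [← hcard]
      exact hcm.trans (Finset.card_le_card (hsub m hem))
    · rw [heq]
      refine Finset.Subset.antisymm ?_ ((Finset.subset_biUnion_of_mem F (Finset.mem_filter.2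
        ⟨Finset.mem_univ m, hum, rfl⟩)).trans (Finset.subset_insert _ _))
      refine Finset.insert_subset hum (Finset.biUnion_subset.2 fun i hi => ?_)
      obtain ⟨-, hui, hci⟩ := Finset.mem_filter.1 hi
      rcases hF i m with h1 | h1 | h1
      · exact absurd hum (Finset.disjoint_left.1 h1 hui)
      · exact h1
      · -- a larger member of the same capacity contains no further element of `S`
        have h2 : S ∩ F m = S ∩ F i := Finset.eq_of_subset_of_card_le
          (Finset.inter_subset_inter_left h1) ((hS i).trans (hci.le.trans hcm))
        have hei : e ∉ F i := fun hei => hem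
          (Finset.mem_inter.1 (h2 ▸ Finset.mem_inter.2 ⟨he, hei⟩ : e ∈ S ∩ F m)).2
        rw [← heq]
        exact subset_tightBlock hui hei (by rw [← h2, hci]; exact hcm)

/-- Descent in the spanner tree: `R` is the union of the blocks removed so far. Each removed block
contains an element of `S \ {e}`, and the blocks are disjoint, so at most `k - 1` of them occur. -/
theorem exists_mem_spannerTree (hF : IsLaminarFamily F)
    {𝒮 : Set (Seminorm ℝ (EuclideanSpace ℝ (Fin d)))} {κ : ℝ}
    {v : Fin n → EuclideanSpace ℝ (Fin d)} {sp : Finset (Fin n) → Finset (Fin n)}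
    {V : Finset (Fin n)} (hV : ∀ u ∈ V, ∀ i, u ∈ F i → 1 ≤ cap i)
    (hsp : ∀ X ⊆ V, IsSpanner 𝒮 κ v X (sp X))
    {N : Seminorm ℝ (EuclideanSpace ℝ (Fin d))} (hN : N ∈ 𝒮) {S : Finset (Fin n)}
    (hS : CapIndep F cap S) (hSk : S.card = k) {e : Fin n} (he : e ∈ S) (heV : e ∈ V) (l : ℕ) :
    ∀ R : Finset (Fin n), e ∉ R →
      (∀ u, IsBlocked F cap S e u → u ∉ R → Disjoint (tightBlock F cap S e u) R) →
      (S.erase e \ R).card ≤ l →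
      ∃ u ∈ spannerTree F cap k sp l (V \ R), ¬ IsBlocked F cap S e u ∧ N (v e) ≤ κ * N (v u) := by
  induction l with
  | zero =>
    intro R heR hR hl
    obtain ⟨u, hu, hNu⟩ := (hsp (V \ R) Finset.sdiff_subset).2 N hN e
      (Finset.mem_sdiff.2 ⟨heV, heR⟩)
    obtain ⟨huV, huR⟩ := Finset.mem_sdiff.1 ((hsp (V \ R) Finset.sdiff_subset).1 hu)
    refine ⟨u, hu, fun hb => ?_, hNu⟩
    obtain ⟨x, hxS, hx⟩ := exists_mem_erase_mem_tightBlock hF hb (hV u huV)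
    have h1 : x ∈ S.erase e \ R :=
      Finset.mem_sdiff.2 ⟨hxS, Finset.disjoint_left.1 (hR u hb huR) hx⟩
    exact (Finset.card_pos.2 ⟨x, h1⟩).not_ge hl
  | succ l ih =>
    intro R heR hR hl
    obtain ⟨u, hu, hNu⟩ := (hsp (V \ R) Finset.sdiff_subset).2 N hN e
      (Finset.mem_sdiff.2 ⟨heV, heR⟩)
    obtain ⟨huV, huR⟩ := Finset.mem_sdiff.1 ((hsp (V \ R) Finset.sdiff_subset).1 hu)
    by_cases hb : IsBlocked F cap S e u
    · obtain ⟨x, hxS, hx⟩ := exists_mem_erase_mem_tightBlock hF hb (hV u huV)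
      obtain ⟨c, hc, hcu⟩ := exists_capBlock_eq_tightBlock hF hS hSk he hb (hV u huV)
      have hxR : x ∈ S.erase e \ R :=
        Finset.mem_sdiff.2 ⟨hxS, Finset.disjoint_left.1 (hR u hb huR) hx⟩
      obtain ⟨w, hw, hwb, hNw⟩ := ih (R ∪ tightBlock F cap S e u)
        (fun h => (Finset.mem_union.1 h).elim heR (notMem_tightBlock hb))
        (fun u' hb' hu' => by
          rw [Finset.mem_union, not_or] at hu'
          exact Finset.disjoint_union_right.2
            ⟨hR u' hb' hu'.1, disjoint_tightBlock hF hu'.2⟩)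
        (by
          have h1 : S.erase e \ (R ∪ tightBlock F cap S e u) ⊂ S.erase e \ R := by
            refine (Finset.ssubset_iff_of_subset (Finset.sdiff_subset_sdiff subset_rfl
              Finset.subset_union_left)).2 ⟨x, hxR, fun h => ?_⟩
            exact (Finset.mem_sdiff.1 h).2 (Finset.mem_union_right _ hx)
          have h2 := Finset.card_lt_card h1
          omega)
      refine ⟨w, Finset.mem_union_right _ (Finset.mem_biUnion.2 ⟨u, hu,
        Finset.mem_biUnion.2 ⟨c, hc, ?_⟩⟩), hwb, hNw⟩
      rwa [hcu, sdiff_sdiff_left]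
    · exact ⟨u, subset_spannerTree _ _ hu, hb, hNu⟩

/-- The spanner tree over the elements that lie in no member of capacity zero. -/
def laminarCoreset (F : Fin t → Finset (Fin n)) (cap : Fin t → ℕ) (k : ℕ)
    (sp : Finset (Fin n) → Finset (Fin n)) (V : Finset (Fin n)) : Finset (Fin n) :=
  spannerTree F cap k sp (k - 1) (V.filter fun u => ∀ i, u ∈ F i → 1 ≤ cap i)

/-- An element found by `exists_mem_spannerTree` starting from `R = ∅` can be exchanged for `e`.
Loops are left out because they lie in no base and may lie in tight members disjoint from `S`. -/
theorem isExchangeSet_laminarCoreset {hF : IsLaminarFamily F}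
    (hM : (laminarMatroid F hF cap).eRank = k)
    {𝒮 : Set (Seminorm ℝ (EuclideanSpace ℝ (Fin d)))}
    {𝒢 : Finset (Fin n) → Set (Seminorm ℝ (EuclideanSpace ℝ (Fin d)))}
    (h𝒢 : ∀ I : Finset (Fin n), I.card < k → 𝒢 I ⊆ 𝒮) {κ : ℝ}
    {v : Fin n → EuclideanSpace ℝ (Fin d)} {sp : Finset (Fin n) → Finset (Fin n)}
    {V : Finset (Fin n)} (hsp : ∀ X ⊆ V, IsSpanner 𝒮 κ v X (sp X)) :
    IsExchangeSet (laminarMatroid F hF cap) 𝒢 κ v V (laminarCoreset F cap k sp V) := by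
  set V' := V.filter fun u => ∀ i, u ∈ F i → 1 ≤ cap i with hV'
  have hV'V : V' ⊆ V := Finset.filter_subset _ _
  refine ⟨(spannerTree_subset (V := V) (fun X hX => (hsp X hX).1) _ V' hV'V).trans hV'V, ?_⟩
  intro S hS e heS heV _ N hN
  obtain ⟨hcap, hcard⟩ := (laminarMatroid_isBase_iff hM).1 hS
  have hI : (S.erase e).card = k - 1 := by rw [Finset.card_erase_of_mem heS, hcard]
  have hk : 0 < k := hcard ▸ Finset.card_pos.2 ⟨e, heS⟩
  have heV' : e ∈ V' := Finset.mem_filter.2 ⟨heV, fun i hei =>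
    (Finset.card_pos.2 ⟨e, Finset.mem_inter.2 ⟨heS, hei⟩⟩ : 0 < (S ∩ F i).card).trans_le (hcap i)⟩
  obtain ⟨u, hu, hub, hNu⟩ := exists_mem_spannerTree hF
    (fun u hu => (Finset.mem_filter.1 hu).2) (fun X hX => hsp X (hX.trans hV'V))
    (h𝒢 _ (by omega) hN) hcap hcard heS heV' (k - 1) ∅ (Finset.notMem_empty e)
    (fun _ _ _ => Finset.disjoint_empty_right _) (by rw [Finset.sdiff_empty, hI])
  rw [Finset.sdiff_empty] at hu
  have huI : u ∉ S.erase e := fun h => hub (Or.inl h)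
  refine ⟨u, hu, huI, laminarMatroid_isBase_exchange hM hS heS huI fun i hui hei => ?_, hNu⟩
  by_contra! hi
  exact hub (Or.inr ⟨i, hui, hei, hi⟩)

theorem card_laminarCoreset_le {sp : Finset (Fin n) → Finset (Fin n)} {b : ℕ} (hb : 1 ≤ b)
    (hk : 1 ≤ k) (hsp : ∀ X, (sp X).card ≤ b) (V : Finset (Fin n)) :
    (laminarCoreset F cap k sp V).card ≤ (b * k) ^ k := by
  have h := card_spannerTree_le (F := F) (cap := cap) hb hk hsp (k - 1)
    (V.filter fun u => ∀ i, u ∈ F i → 1 ≤ cap i)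
  rwa [Nat.sub_add_cancel hk] at h

variable {hF : IsLaminarFamily F}

theorem laminarMatroid_hasComposableCoreset_of_le
    (hM : (laminarMatroid F hF cap).eRank = k) (hkd : k ≤ d) :
    HasComposableCoreset (laminarMatroid F hF cap) d ((k : ℝ) ^ (2 * k)) (k ^ (2 * k)) := by
  rcases Nat.eq_zero_or_pos k with rfl | hk
  · exact hasComposableCoreset_of_eRank_eq_zero hM (by simp) _
  refine hasComposableCoreset_of_spanners (fun v X => exists_isSpanner_dist v X hk)
    (laminarCoreset F cap k) ?_
    (fun v sp V hsp => isExchangeSet_laminarCoreset hM (fun I hI => spanDistances_subset hI) hsp)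
    (fun v c => isComposableCoreset_of_le hM hkd)
  intro sp V hsp
  rw [pow_mul, sq]
  exact card_laminarCoreset_le hk hk hsp V

theorem laminarMatroid_hasComposableCoreset_of_ge
    (hM : (laminarMatroid F hF cap).eRank = k) (hd : 1 ≤ d) (hdk : d ≤ k) :
    HasComposableCoreset (laminarMatroid F hF cap) d ((d : ℝ) ^ (2 * d)) ((k * d) ^ k) := by
  have hfin : finrank ℝ (EuclideanSpace ℝ (Fin d)) = d := finrank_euclideanSpace_fin
  refine hasComposableCoreset_of_spanners (b₀ := d) (κ := d) (𝒮 := Set.univ)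
    (fun v X => by simpa only [hfin] using exists_isSpanner_univ v X (hd.trans_eq hfin.symm))
    (laminarCoreset F cap k) ?_
    (fun v sp V hsp => isExchangeSet_laminarCoreset hM (fun _ _ => Set.subset_univ _) hsp)
    (fun v c => isComposableCoreset_of_ge hM hd hdk)
  intro sp V hsp
  rw [mul_comm k d]
  exact card_laminarCoreset_le hd (hd.trans hdk) hsp V
end Laminar

end

/-! ### The size bounds -/

theorem HasComposableCoreset.mono {n d : ℕ} {M : Matroid (Fin n)} {α : ℝ} {b b' : ℕ}
    (h : HasComposableCoreset M d α b) (hb : b ≤ b') : HasComposableCoreset M d α b' := by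
  obtain ⟨c, hloc, hc⟩ := h
  exact ⟨c, hloc, fun v => ⟨(hc v).1, fun V => ((hc v).2 V).trans hb⟩⟩

theorem mainTheorem2 :
    ∃ C : ℕ,
      (∀ (n d s k : ℕ) (_ : 1 ≤ d) (P : Fin s → Finset (Fin n)) (hP : IsIndexedPartition P)
          (cap : Fin s → ℕ) (_ : (partitionMatroid P hP cap).eRank = k),
        (k ≤ d →
          HasComposableCoreset (partitionMatroid P hP cap) d ((k : ℝ) ^ (2 * k)) (C * (s * k))) ∧
        (d ≤ k →
          HasComposableCoreset (partitionMatroid P hP cap) d ((d : ℝ) ^ (2 * d)) (C * (k * d)))) ∧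
      (∀ (n d t k : ℕ) (_ : 1 ≤ d) (F : Fin t → Finset (Fin n)) (hF : IsLaminarFamily F)
          (cap : Fin t → ℕ) (_ : (laminarMatroid F hF cap).eRank = k),
        (k ≤ d →
          HasComposableCoreset (laminarMatroid F hF cap) d ((k : ℝ) ^ (2 * k))
            (C * k ^ (2 * k))) ∧
        (d ≤ k →
          HasComposableCoreset (laminarMatroid F hF cap) d ((d : ℝ) ^ (2 * d))
            (C * (k * d) ^ k))) := by
  refine ⟨2, fun n d s k hd P hP cap hM => ⟨fun h => ?_, fun h => ?_⟩,
    fun n d t k hd F hF cap hM => ⟨fun h => ?_, fun h => ?_⟩⟩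
  · exact partitionMatroid_hasComposableCoreset_of_le hM h
  · exact (partitionMatroid_hasComposableCoreset_of_ge hM hd h).mono
      (Nat.le_mul_of_pos_left _ two_pos)
  · exact (laminarMatroid_hasComposableCoreset_of_le hM h).mono
      (Nat.le_mul_of_pos_left _ two_pos)
  · exact (laminarMatroid_hasComposableCoreset_of_ge hM hd h).mono
      (Nat.le_mul_of_pos_left _ two_pos)
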